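/- Let $G\rightrightarrows M$ be an étale and proper Lie groupoid (with $M$ and $G$ Hausdorff, second countable smooth manifolds) whose orbit space $M/G$ is compact, and which is $G$-connected: any two points of $M$ are joined by a $G$-path, i.e. by a sequence $\sigma=\sigma_n g_n\sigma_{n-1}\cdots\sigma_1 g_1\sigma_0$ of smooth paths $\sigma_j:[0,1]\to M$ and arrows $g_j:\sigma_{j-1}(1)\to\sigma_j(0)$ of $G$. Let $s,t:G\to M$ be the source and target maps and let $$H^1_{\mathrm{bas}}(G,\mathbb{R})=\frac{\{\omega\in\Omega^1(M): d\omega=0,\ s^*\omega=t^*\omega\}}{\{df: f\in C^\infty(M),\ s^*f=t^*f\}}$$ be the first basic cohomology. Let $H_1(G,\mathbb{Z})$ be the first total singular homology group of $G$ (the homology of the total complex of singular chains on the nerve of $G$). The homomorphism of periods of $\xi=[\omega]\in H^1_{\mathrm{bas}}(G,\mathbb{R})$ is the homomorphism $\mathrm{Per}_\xi:H_1(G,\mathbb{Z})\to\mathbb{R}$ that takes the homology class $|\sigma|$ of each $G$-loop $\sigma$ (a $G$-path with $\sigma_0(0)=\sigma_n(1)$) to $\int_\sigma\omega=\sum_{k=0}^n\int_{\sigma_k}\omega$,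 and the rank of $\xi$ is the rank of the abelian group $\mathrm{Per}_\xi(H_1(G,\mathbb{Z}))\subset\mathbb{R}$. Assume that $H^1_{\mathrm{bas}}(G,\mathbb{R})\neq 0$. Then $H^1_{\mathrm{bas}}(G,\mathbb{R})$ is a finite-dimensional real vector space, and the set of classes of rank $1$ is dense in it (for the canonical topology of a finite-dimensional real vector space). -/

import Mathlib

open scoped Manifold ContDiff
open Set

noncomputable section

/-- The data and laws of a Lie groupoid `G ⇉ M`, where `M` is a manifold modelled on `E` and
`G` is a manifold modelled on `F`. The product `mul g h` stands for the composite arrow `gh`; it is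
meaningful only if `src g = tgt h`, i.e. on `G⁽²⁾`, and all laws are restricted to such pairs. -/
structure LieGroupoid (E F M G : Type*)
    [NormedAddCommGroup E] [NormedSpace ℝ E] [NormedAddCommGroup F] [NormedSpace ℝ F]
    [TopologicalSpace M] [ChartedSpace E M] [TopologicalSpace G] [ChartedSpace F G] where
  /-- source -/
  src : G → M
  /-- target -/
  tgt : G → M
  /-- units -/
  one : M → G
  /-- inversion -/
  inv : G → G
  /-- partial composition -/
  mul : G → G → G
  src_one : ∀ x, src (one x) = x
  tgt_one : ∀ x, tgt (one x) = x
  src_inv : ∀ g, src (inv g) = tgt g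
  tgt_inv : ∀ g, tgt (inv g) = src g
  src_mul : ∀ g h, src g = tgt h → src (mul g h) = src h
  tgt_mul : ∀ g h, src g = tgt h → tgt (mul g h) = tgt g
  mul_assoc : ∀ g h k, src g = tgt h → src h = tgt k → mul (mul g h) k = mul g (mul h k)
  one_mul : ∀ g, mul (one (tgt g)) g = g
  mul_one : ∀ g, mul g (one (src g)) = g
  inv_mul : ∀ g, mul (inv g) g = one (src g)
  mul_inv : ∀ g, mul g (inv g) = one (tgt g)
  contMDiff_src : ContMDiff 𝓘(ℝ, F) 𝓘(ℝ, E) ∞ src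
  contMDiff_tgt : ContMDiff 𝓘(ℝ, F) 𝓘(ℝ, E) ∞ tgt
  contMDiff_one : ContMDiff 𝓘(ℝ, E) 𝓘(ℝ, F) ∞ one
  contMDiff_inv : ContMDiff 𝓘(ℝ, F) 𝓘(ℝ, F) ∞ inv
  submersion_src : ∀ g, Function.Surjective (mfderiv 𝓘(ℝ, F) 𝓘(ℝ, E) src g)
  submersion_tgt : ∀ g, Function.Surjective (mfderiv 𝓘(ℝ, F) 𝓘(ℝ, E) tgt g)
  /-- Composition is smooth on the embedded submanifold `G⁽²⁾` of `G × G`. -/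
  contMDiffOn_mul : ContMDiffOn (𝓘(ℝ, F).prod 𝓘(ℝ, F)) 𝓘(ℝ, F) ∞
    (fun p : G × G => mul p.1 p.2) {p | src p.1 = tgt p.2}

/-! ### Differential 1-forms on a manifold -/

/-- Smooth differential `1`-forms on `M`: smooth sections of the cotangent bundle. -/
abbrev OneForm (E M : Type*) [NormedAddCommGroup E] [NormedSpace ℝ E]
    [TopologicalSpace M] [ChartedSpace E M] [IsManifold 𝓘(ℝ, E) ∞ M] : Type _ :=
  Cₛ^∞⟮𝓘(ℝ, E); E →L[ℝ] ℝ, fun x : M => TangentSpace 𝓘(ℝ, E) x →L[ℝ] Bundle.Trivial M ℝ x⟯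

namespace OneForm

variable {E M : Type*} [NormedAddCommGroup E] [NormedSpace ℝ E]
    [TopologicalSpace M] [ChartedSpace E M] [IsManifold 𝓘(ℝ, E) ∞ M]

/-- The value of a `1`-form at a point, as a linear functional on the tangent space. -/
def evalAt (θ : OneForm E M) (x : M) : TangentSpace 𝓘(ℝ, E) x →L[ℝ] ℝ := θ x

/-- The pull-back of `θ` under the inverse of the chart around `x₀`, evaluated at the point `y` of
the model space and on the constant vector field `v`. -/
def inChart (θ : OneForm E M) (x₀ : M) (y v : E) : ℝ :=
  θ.evalAt ((chartAt E x₀).symm y) (mfderiv 𝓘(ℝ, E) 𝓘(ℝ, E) (chartAt E x₀).symm y v)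

/-- `dθ = 0`. In a chart, and for constant vector fields `u`, `v`, one has
`dθ(u, v) = u(θ(v)) - v(θ(u))`. -/
def IsClosedForm (θ : OneForm E M) : Prop :=
  ∀ x₀ : M, ∀ y ∈ (chartAt E x₀).target, ∀ u v : E,
    fderiv ℝ (fun z => θ.inChart x₀ z v) y u - fderiv ℝ (fun z => θ.inChart x₀ z u) y v = 0

/-- `θ = df`. -/
def IsDifferentialOf (θ : OneForm E M) (f : M → ℝ) : Prop :=
  ∀ x (v : TangentSpace 𝓘(ℝ, E) x), θ.evalAt x v = mfderiv 𝓘(ℝ, E) 𝓘(ℝ, ℝ) f x v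

theorem differentiableAt_inChart (θ : OneForm E M) (x₀ : M) {y : E}
    (hy : y ∈ (chartAt E x₀).target) (v : E) :
    DifferentiableAt ℝ (fun z => θ.inChart x₀ z v) y := by
  set e := chartAt E x₀
  have ho : IsOpen e.target := e.open_target
  have h1 : ContMDiffOn 𝓘(ℝ, E) 𝓘(ℝ, E) ∞ e.symm e.target := contMDiffOn_chart_symm
  have h2 := h1.contMDiffOn_tangentMapWithin (m := 1) (by decide) ho.uniqueMDiffOn
  have h3 : ContMDiffOn 𝓘(ℝ, E) (𝓘(ℝ, E).prod 𝓘(ℝ, E)) 1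
      (fun z => (⟨z, v⟩ : TangentBundle 𝓘(ℝ, E) E)) e.target := by
    intro z _
    exact contMDiffWithinAt_vectorSpace_iff_contDiffWithinAt.2 contDiffWithinAt_const
  have h4 : ContMDiffOn 𝓘(ℝ, E) (𝓘(ℝ, E).prod 𝓘(ℝ, E)) 1
      (fun z => Bundle.TotalSpace.mk' E (e.symm z)
        (mfderivWithin 𝓘(ℝ, E) 𝓘(ℝ, E) e.symm e.target z v)) e.target :=
    h2.comp h3 (fun z hz => hz)
  have h5 : ContMDiffOn 𝓘(ℝ, E) (𝓘(ℝ, E).prod 𝓘(ℝ, E →L[ℝ] ℝ)) 1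
      (fun z => Bundle.TotalSpace.mk' (E →L[ℝ] ℝ)
        (E := fun x : M => TangentSpace 𝓘(ℝ, E) x →L[ℝ] Bundle.Trivial M ℝ x)
        (e.symm z) (θ (e.symm z))) e.target :=
    (θ.contMDiff.of_le (by decide)).comp_contMDiffOn (h1.of_le (by decide))
  have h6 := h5.clm_bundle_apply h4
  have h7 := (Bundle.contMDiffWithinAt_totalSpace.1 (h6 y hy)).2
  have h8 := (h7.contMDiffAt (ho.mem_nhds hy)).contDiffAt.differentiableAt (by decide)
  refine h8.congr_of_eventuallyEq ?_
  filter_upwards [ho.mem_nhds hy] with z hz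
  rw [mfderivWithin_of_isOpen ho hz]
  rfl

end OneForm

/-! ### Singular simplices in low degree

A singular `0`-simplex is a point, a singular `1`-simplex is a continuous map from `[0,1]`, and a
singular `2`-simplex is a continuous map from the standard triangle. -/

namespace SingularChains

/-- The standard `2`-simplex. -/
abbrev Triangle : Type := stdSimplex ℝ (Fin 3)

/-- The edge of the triangle from the vertex `i` to the vertex `j`. -/
def edge (i j : Fin 3) : C(unitInterval, Triangle) where
  toFun r := ⟨(1 - (r : ℝ)) • Pi.single i 1 + (r : ℝ) • Pi.single j 1,
    convex_stdSimplex ℝ (Fin 3) (single_mem_stdSimplex ℝ i) (single_mem_stdSimplex ℝ j)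
      (sub_nonneg.2 r.2.2) r.2.1 (by ring)⟩
  continuous_toFun := by fun_prop

end SingularChains

namespace LieGroupoid

open SingularChains

variable {E F M G : Type*}
    [NormedAddCommGroup E] [NormedSpace ℝ E] [NormedAddCommGroup F] [NormedSpace ℝ F]
    [TopologicalSpace M] [ChartedSpace E M] [TopologicalSpace G] [ChartedSpace F G]
    (𝒢 : LieGroupoid E F M G)

/-! ### Étale and proper groupoids, orbit space -/

/-- Étale: the source or the target map is a local diffeomorphism. -/
def IsEtale : Prop :=
  IsLocalDiffeomorph 𝓘(ℝ, F) 𝓘(ℝ, E) ∞ 𝒢.src ∨ IsLocalDiffeomorph 𝓘(ℝ, F) 𝓘(ℝ, E) ∞ 𝒢.tgt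

/-- Proper: the map `(s, t) : G → M × M` is proper. -/
def IsProper : Prop := IsProperMap fun g => (𝒢.src g, 𝒢.tgt g)

/-- Two points of `M` are in the same orbit iff some arrow joins them. -/
def orbitSetoid : Setoid M where
  r x y := ∃ g, 𝒢.src g = x ∧ 𝒢.tgt g = y
  iseqv :=
    { refl := fun x => ⟨𝒢.one x, 𝒢.src_one x, 𝒢.tgt_one x⟩
      symm := by
        rintro x y ⟨g, rfl, rfl⟩
        exact ⟨𝒢.inv g, 𝒢.src_inv g, 𝒢.tgt_inv g⟩
      trans := by
        rintro x y z ⟨g, rfl, rfl⟩ ⟨h, hs, rfl⟩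
        exact ⟨𝒢.mul h g, 𝒢.src_mul h g hs, 𝒢.tgt_mul h g hs⟩ }

/-- The orbit space `M/G`, with the quotient topology. -/
abbrev OrbitSpace : Type _ := Quotient 𝒢.orbitSetoid

/-! ### `G`-paths -/

/-- A smooth `G`-path `σₙ gₙ σₙ₋₁ ⋯ σ₁ g₁ σ₀` from `x` to `y`: smooth paths `σ₀, …, σₙ` in `M`,
parametrized by `[0,1]` (the values of `path j` outside `[0,1]` are irrelevant), and arrows
`gⱼ : σⱼ₋₁(1) → σⱼ(0)`. Indices of arrows are shifted by one: `arrow j` is `gⱼ₊₁`.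
A piecewise smooth path is covered by inserting unit arrows at its corners. -/
structure GPath (x y : M) where
  /-- the order `n` of the `G`-path -/
  order : ℕ
  /-- the paths `σ₀, …, σₙ` -/
  path : Fin (order + 1) → ℝ → M
  /-- the arrows `g₁, …, gₙ` -/
  arrow : Fin order → G
  smooth_path : ∀ j, ContMDiffOn 𝓘(ℝ, ℝ) 𝓘(ℝ, E) ∞ (path j) (Icc 0 1)
  src_arrow : ∀ j : Fin order, 𝒢.src (arrow j) = path j.castSucc 1
  tgt_arrow : ∀ j : Fin order, 𝒢.tgt (arrow j) = path j.succ 0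
  path_start : path 0 0 = x
  path_end : path (Fin.last order) 1 = y

/-- Any two points are joined by a `G`-path. -/
def IsGConnected : Prop := ∀ x y : M, Nonempty (𝒢.GPath x y)

/-! ### First total singular homology

The total singular complex of the nerve of the groupoid, in degrees `0`, `1` and `2`:
`C₀(M)`, then `C₀(G) ⊕ C₁(M)`, then `C₀(G⁽²⁾) ⊕ C₁(G) ⊕ C₂(M)`. -/

/-- The manifold `G⁽²⁾` of composable pairs, as a type. -/
abbrev Composable : Type _ := {p : G × G // 𝒢.src p.1 = 𝒢.tgt p.2}

/-- Total singular `0`-chains. -/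
abbrev Chain0 (_ : LieGroupoid E F M G) : Type _ := M →₀ ℤ

/-- Total singular `1`-chains. -/
abbrev Chain1 (_ : LieGroupoid E F M G) : Type _ := (G →₀ ℤ) × (C(unitInterval, M) →₀ ℤ)

/-- Total singular `2`-chains. -/
abbrev Chain2 : Type _ :=
  (𝒢.Composable →₀ ℤ) × (C(unitInterval, G) →₀ ℤ) × (C(Triangle, M) →₀ ℤ)

/-- The `1`-chain given by an arrow. -/
def arrowChain (g : G) : 𝒢.Chain1 := (Finsupp.single g 1, 0)

/-- The `1`-chain given by a continuous path in `M`. -/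
def pathChain (γ : C(unitInterval, M)) : 𝒢.Chain1 := (0, Finsupp.single γ 1)

/-- The boundary map `δ(g) = s(g) - t(g)`, `δ(γ) = γ(0) - γ(1)` on total singular `1`-chains. -/
def boundary1 : 𝒢.Chain1 →ₗ[ℤ] 𝒢.Chain0 :=
  LinearMap.coprod
    (Finsupp.linearCombination ℤ fun g : G =>
      Finsupp.single (𝒢.src g) (1 : ℤ) - Finsupp.single (𝒢.tgt g) 1)
    (Finsupp.linearCombination ℤ fun γ : C(unitInterval, M) =>
      Finsupp.single (γ 0) (1 : ℤ) - Finsupp.single (γ 1) 1)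

/-- The source of a path of arrows. -/
def srcPath (τ : C(unitInterval, G)) : C(unitInterval, M) :=
  ⟨fun r => 𝒢.src (τ r), 𝒢.contMDiff_src.continuous.comp τ.continuous⟩

/-- The target of a path of arrows. -/
def tgtPath (τ : C(unitInterval, G)) : C(unitInterval, M) :=
  ⟨fun r => 𝒢.tgt (τ r), 𝒢.contMDiff_tgt.continuous.comp τ.continuous⟩

/-- The boundary map on total singular `2`-chains: `δ(g, h) = h - gh + g` on composable pairs,
`δ(τ) = (t ∘ τ - s ∘ τ) - (τ(1) - τ(0))` on paths of arrows, and the alternating sum of the faces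
on singular triangles in `M`. -/
def boundary2 : 𝒢.Chain2 →ₗ[ℤ] 𝒢.Chain1 :=
  LinearMap.coprod
    (Finsupp.linearCombination ℤ fun p : 𝒢.Composable =>
      𝒢.arrowChain p.1.2 - 𝒢.arrowChain (𝒢.mul p.1.1 p.1.2) + 𝒢.arrowChain p.1.1)
    (LinearMap.coprod
      (Finsupp.linearCombination ℤ fun τ : C(unitInterval, G) =>
        (𝒢.pathChain (𝒢.tgtPath τ) - 𝒢.pathChain (𝒢.srcPath τ))
          - (𝒢.arrowChain (τ 1) - 𝒢.arrowChain (τ 0)))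
      (Finsupp.linearCombination ℤ fun κ : C(Triangle, M) =>
        𝒢.pathChain (κ.comp (edge 1 2)) - 𝒢.pathChain (κ.comp (edge 0 2))
          + 𝒢.pathChain (κ.comp (edge 0 1))))

/-- Total singular `1`-cycles. -/
abbrev Cycle1 : Submodule ℤ 𝒢.Chain1 := LinearMap.ker 𝒢.boundary1

/-- The first total singular homology group `H₁(G, ℤ)`: cycles modulo boundaries. -/
abbrev H1 : Type _ := 𝒢.Cycle1 ⧸ (LinearMap.range 𝒢.boundary2).submoduleOf 𝒢.Cycle1

namespace GPath

variable {𝒢} {x y : M} (σ : 𝒢.GPath x y)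

/-- The path `σⱼ` as a singular `1`-simplex. -/
def simplex (j : Fin (σ.order + 1)) : C(unitInterval, M) :=
  ⟨fun r => σ.path j r, (σ.smooth_path j).continuousOn.comp_continuous
    continuous_subtype_val fun r => r.2⟩

/-- The total singular `1`-chain `∑ gⱼ + ∑ σⱼ`. -/
def chain : 𝒢.Chain1 :=
  ∑ j, 𝒢.arrowChain (σ.arrow j) + ∑ j, 𝒢.pathChain (σ.simplex j)

theorem boundary1_chain :
    𝒢.boundary1 σ.chain = Finsupp.single x (1 : ℤ) - Finsupp.single y 1 := by
  have h1 : ∀ g : G, 𝒢.boundary1 (𝒢.arrowChain g) =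
      Finsupp.single (𝒢.src g) (1 : ℤ) - Finsupp.single (𝒢.tgt g) 1 := by
    intro g; simp [boundary1, arrowChain]
  have h2 : ∀ γ : C(unitInterval, M), 𝒢.boundary1 (𝒢.pathChain γ) =
      Finsupp.single (γ 0) (1 : ℤ) - Finsupp.single (γ 1) 1 := by
    intro γ; simp [boundary1, pathChain]
  have h3 : ∀ j, σ.simplex j 0 = σ.path j 0 := fun j => by simp [simplex]
  have h4 : ∀ j, σ.simplex j 1 = σ.path j 1 := fun j => by simp [simplex]
  simp only [chain, map_add, map_sum, h1, h2, h3, h4, σ.src_arrow, σ.tgt_arrow,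
    Finset.sum_sub_distrib]
  rw [Fin.sum_univ_succ (fun j => Finsupp.single (σ.path j 0) (1 : ℤ)),
    Fin.sum_univ_castSucc (fun j => Finsupp.single (σ.path j 1) (1 : ℤ)),
    σ.path_start, σ.path_end]
  abel

/-- The homology class `|σ| ∈ H₁(G, ℤ)` of a `G`-loop `σ`. -/
def homologyClass (σ : 𝒢.GPath x x) : 𝒢.H1 :=
  Submodule.Quotient.mk ⟨σ.chain, by
    rw [LinearMap.mem_ker, boundary1_chain, sub_self]⟩

/-- The `G`-path integral `∑ₖ ∫_{σₖ} θ`. -/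
def integral [IsManifold 𝓘(ℝ, E) ∞ M] (θ : OneForm E M) : ℝ :=
  ∑ k, ∫ r in (0 : ℝ)..1,
    θ.evalAt (σ.path k r) (mfderivWithin 𝓘(ℝ, ℝ) 𝓘(ℝ, E) (σ.path k) (Icc 0 1) r (1 : ℝ))

end GPath

/-! ### Basic cohomology in degree one -/

section Basic

variable [IsManifold 𝓘(ℝ, E) ∞ M]

/-- `s^*θ = t^*θ`. -/
def IsBasicForm (θ : OneForm E M) : Prop :=
  ∀ (g : G) (v : TangentSpace 𝓘(ℝ, F) g),
    θ.evalAt (𝒢.src g) (mfderiv 𝓘(ℝ, F) 𝓘(ℝ, E) 𝒢.src g v) =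
      θ.evalAt (𝒢.tgt g) (mfderiv 𝓘(ℝ, F) 𝓘(ℝ, E) 𝒢.tgt g v)

/-- Smooth functions `f : M → ℝ` with `s^*f = t^*f`. -/
def IsBasicFunction (f : M → ℝ) : Prop :=
  ContMDiff 𝓘(ℝ, E) 𝓘(ℝ, ℝ) ∞ f ∧ ∀ g, f (𝒢.src g) = f (𝒢.tgt g)

/-- Closed basic `1`-forms. -/
def closedBasicForms : Submodule ℝ (OneForm E M) where
  carrier := {θ | θ.IsClosedForm ∧ 𝒢.IsBasicForm θ}
  zero_mem' := by
    refine ⟨fun x₀ y _ u v => ?_, fun g v => ?_⟩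
    · have h : ∀ w : E, (fun z => (0 : OneForm E M).inChart x₀ z w) = fun _ => 0 := fun w => rfl
      rw [h, h]; simp
    · rfl
  add_mem' := by
    rintro a b ⟨ha, ha'⟩ ⟨hb, hb'⟩
    refine ⟨fun x₀ y hy u v => ?_, fun g v => ?_⟩
    · have h : ∀ w : E, (fun z => (a + b).inChart x₀ z w) =
          (fun z => a.inChart x₀ z w) + fun z => b.inChart x₀ z w := fun w => rfl
      have h' : ∀ w : E, fderiv ℝ (fun z => (a + b).inChart x₀ z w) y =
          fderiv ℝ (fun z => a.inChart x₀ z w) y + fderiv ℝ (fun z => b.inChart x₀ z w) y :=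
        fun w => by
          rw [h, fderiv_add (a.differentiableAt_inChart x₀ hy w)
            (b.differentiableAt_inChart x₀ hy w)]
      have h1 := ha x₀ y hy u v
      have h2 := hb x₀ y hy u v
      rw [h', h', add_apply, add_apply]
      linarith
    · exact congrArg₂ (· + ·) (ha' g v) (hb' g v)
  smul_mem' := by
    rintro c a ⟨ha, ha'⟩
    refine ⟨fun x₀ y hy u v => ?_, fun g v => ?_⟩
    · have h : ∀ w : E, (fun z => (c • a).inChart x₀ z w) =
          c • fun z => a.inChart x₀ z w := fun w => rfl
      have h' : ∀ w : E, fderiv ℝ (fun z => (c • a).inChart x₀ z w) y =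
          c • fderiv ℝ (fun z => a.inChart x₀ z w) y :=
        fun w => by rw [h, fderiv_const_smul (a.differentiableAt_inChart x₀ hy w)]
      have h1 := ha x₀ y hy u v
      rw [h', h', smul_apply, smul_apply, ← smul_sub, h1,
        smul_zero]
    · exact congrArg (c * ·) (ha' g v)

/-- Closed basic `1`-forms that are differentials of basic functions. -/
def exactBasicForms : Submodule ℝ 𝒢.closedBasicForms where
  carrier := {θ | ∃ f, 𝒢.IsBasicFunction f ∧ (θ : OneForm E M).IsDifferentialOf f}
  zero_mem' := by
    refine ⟨fun _ => 0, ⟨contMDiff_const, fun _ => rfl⟩, fun x v => ?_⟩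
    rw [mfderiv_const]; rfl
  add_mem' := by
    rintro a b ⟨f, hf, hf'⟩ ⟨k, hk, hk'⟩
    refine ⟨f + k, ⟨hf.1.add hk.1, fun g => congrArg₂ (· + ·) (hf.2 g) (hk.2 g)⟩, fun x v => ?_⟩
    rw [mfderiv_add (hf.1.mdifferentiableAt (by decide)) (hk.1.mdifferentiableAt (by decide))]
    exact congrArg₂ (· + ·) (hf' x v) (hk' x v)
  smul_mem' := by
    rintro c a ⟨f, hf, hf'⟩
    refine ⟨c • f, ⟨(contDiff_const_smul c).contMDiff.comp hf.1, fun g => congrArg (c * ·) (hf.2 g)⟩, fun x v => ?_⟩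
    rw [const_smul_mfderiv (hf.1.mdifferentiableAt (by decide))]
    exact congrArg (c * ·) (hf' x v)

/-- The basic cohomology `H¹_bas(G, ℝ)`. -/
abbrev BasicH1 : Type _ := 𝒢.closedBasicForms ⧸ 𝒢.exactBasicForms

/-- The basic cohomology class of a closed basic `1`-form. -/
def basicClass (θ : 𝒢.closedBasicForms) : 𝒢.BasicH1 := Submodule.Quotient.mk θ

/-- `P : H₁(G, ℤ) → ℝ` is the homomorphism of periods of the class `ξ`: it takes the homology class
of every smooth `G`-loop `σ` to `∫_σ θ`, for the closed basic forms `θ` in the class `ξ`. -/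
def IsPeriodHom (ξ : 𝒢.BasicH1) (P : 𝒢.H1 →+ ℝ) : Prop :=
  ∀ θ : 𝒢.closedBasicForms, 𝒢.basicClass θ = ξ →
    ∀ (x : M) (σ : 𝒢.GPath x x), P σ.homologyClass = σ.integral (θ : OneForm E M)

/-- The rank of `ξ`, i.e. the rank of the group of its periods, equals `r`. -/
def HasRank (ξ : 𝒢.BasicH1) (r : ℕ) : Prop :=
  ∃ P : 𝒢.H1 →+ ℝ, 𝒢.IsPeriodHom ξ P ∧ Module.rank ℤ P.range = r

end Basic

end LieGroupoid

end

/-! Locally a closed basic form θ is df, with f unique up to a constant, and arrows preserve these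
local primitives up to constants. The constants carry all the global information. For a subgroup Q
of ℝ, a primitive of θ modulo Q (`IsPrimitiveModulo`) is a function q on M, possibly discontinuous,
that differs near each point from some local primitive by values in Q and is invariant modulo Q. If
it exists, all periods lie in Q; for Q = 0 the form is the differential of a basic function. On a
G-connected groupoid, vanishing periods also force exactness, by integration from a base point
(`IsGConnected.mem_exactBasicForms`).

Finiteness: finitely many compact sets, each inside a set where primitives can be chosen linearly in
θ, meet all orbits. The jump of these primitives across an arrow is a locally constant functional of
the arrow, and by properness the relevant arrows form compact sets, so only finitely many
functionals occur. Modulo the group generated by their values at θ, every θ has an invariant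
primitive (`exists_finite_functionals`). A form killed by all of them is exact, so the cohomology is
finite-dimensional.

Density: the jumps of θ span a finite-dimensional ℚ-space A in ℝ with a basis b_i. Each coordinate
extends to an additive, usually discontinuous, map ψ_i from ℝ to ℚ. Composing local primitives with
ψ_i destroys smoothness, but only by an invariant function: averaging over the fibres of the source
map yields an invariant u_i with all u_i + ψ_i ∘ f smooth (`exists_smooth_add_comp`). These are
local primitives of a closed basic form η_i that has a primitive modulo ℚ, and [θ] = ∑ b_i [η_i]
because x = ∑ b_i ψ_i(x) on A (`exists_eq_sum_smul_rational`). Replacing the b_i by nearby rationals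
approximates [θ] by classes with rational periods. Such a class, if nonzero, has a nonzero period
and hence rank one; zero can be left out because it is not isolated in a nontrivial real vector
space. -/

noncomputable section

open Filter Topology

/-! ### Locally constant functions on manifolds -/

/-- A real function that is locally constant around every point of a preconnected set is constant
on it. -/
theorem IsPreconnected.eq_of_eventually_eq {X Y : Type*} [TopologicalSpace X] {V : Set X}
    (hV : IsPreconnected V) {w : X → Y} (hw : ∀ x ∈ V, ∀ᶠ y in 𝓝[V] x, w y = w x)
    {x y : X} (hx : x ∈ V) (hy : y ∈ V) : w x = w y := by
  have : PreconnectedSpace V := isPreconnected_iff_preconnectedSpace.1 hV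
  have h : IsLocallyConstant fun z : V => w z := by
    rw [IsLocallyConstant.iff_eventually_eq]
    intro z
    have := hw z z.2
    rw [nhdsWithin_eq_map_subtype_coe z.2] at this
    exact this
  exact h.apply_eq_of_preconnectedSpace ⟨x, hx⟩ ⟨y, hy⟩

/-! ### Derivatives read in charts. -/

section Charts

variable {E M : Type*} [NormedAddCommGroup E] [NormedSpace ℝ E]
    [TopologicalSpace M] [ChartedSpace E M] [IsManifold 𝓘(ℝ, E) ∞ M]

theorem mdifferentiableAt_chartAt_symm (x₀ : M) {y : E} (hy : y ∈ (chartAt E x₀).target) :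
    MDifferentiableAt 𝓘(ℝ, E) 𝓘(ℝ, E) (chartAt E x₀).symm y :=
  (contMDiffOn_chart_symm (n := ∞) (I := 𝓘(ℝ, E)) |>.contMDiffAt
    ((chartAt E x₀).open_target.mem_nhds hy)).mdifferentiableAt (by decide)

theorem mdifferentiableAt_chartAt (x₀ : M) {x : M} (hx : x ∈ (chartAt E x₀).source) :
    MDifferentiableAt 𝓘(ℝ, E) 𝓘(ℝ, E) (chartAt E x₀) x :=
  (contMDiffOn_chart (n := ∞) (I := 𝓘(ℝ, E)) |>.contMDiffAt
    ((chartAt E x₀).open_source.mem_nhds hx)).mdifferentiableAt (by decide)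

theorem mfderiv_chartAt_symm_mfderiv_chartAt (x₀ : M) {x : M} (hx : x ∈ (chartAt E x₀).source)
    (v : TangentSpace 𝓘(ℝ, E) x) :
    (mfderiv 𝓘(ℝ, E) 𝓘(ℝ, E) (chartAt E x₀).symm (chartAt E x₀ x)
      (mfderiv 𝓘(ℝ, E) 𝓘(ℝ, E) (chartAt E x₀) x v) : E) = v := by
  set e := chartAt E x₀
  have h := mfderiv_comp x (I := 𝓘(ℝ, E)) (I' := 𝓘(ℝ, E)) (I'' := 𝓘(ℝ, E))
    (mdifferentiableAt_chartAt_symm x₀ (e.map_source hx)) (mdifferentiableAt_chartAt x₀ hx)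
  have h2 : (e.symm ∘ e) =ᶠ[𝓝 x] id := by
    filter_upwards [e.open_source.mem_nhds hx] with z hz using e.left_inv hz
  rw [h2.mfderiv_eq, mfderiv_id] at h
  exact (congrArg (fun L : E →L[ℝ] E => L v) h).symm

/-- The derivative of a function read in a chart. -/
theorem fderiv_comp_chartAt_symm (x₀ : M) {f : M → ℝ} {y : E} (hy : y ∈ (chartAt E x₀).target)
    (hf : MDifferentiableAt 𝓘(ℝ, E) 𝓘(ℝ, ℝ) f ((chartAt E x₀).symm y)) (v : E) :
    fderiv ℝ (f ∘ (chartAt E x₀).symm) y v =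
      mfderiv 𝓘(ℝ, E) 𝓘(ℝ, ℝ) f ((chartAt E x₀).symm y)
        (mfderiv 𝓘(ℝ, E) 𝓘(ℝ, E) (chartAt E x₀).symm y v) := by
  rw [← mfderiv_eq_fderiv, mfderiv_comp y hf (mdifferentiableAt_chartAt_symm x₀ hy)]
  rfl

omit [NormedSpace ℝ E] [IsManifold 𝓘(ℝ, E) ∞ M] in
theorem exists_ball_subset_target (x : M) {U : Set M} (hU : U ∈ 𝓝 x) :
    ∃ r > 0, Metric.ball (chartAt E x x) r ⊆ (chartAt E x).target ∧
      ∀ y ∈ Metric.ball (chartAt E x x) r, (chartAt E x).symm y ∈ U := by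
  set e := chartAt E x
  have h1 : e.target ∈ 𝓝 (e x) := e.open_target.mem_nhds (e.map_source (mem_chart_source E x))
  have h2 : e.symm ⁻¹' U ∈ 𝓝 (e x) := by
    apply e.symm.continuousAt (e.map_source (mem_chart_source E x))
    rwa [e.left_inv (mem_chart_source E x)]
  obtain ⟨r, hr, h⟩ := Metric.mem_nhds_iff.1 (inter_mem h1 h2)
  exact ⟨r, hr, fun y hy => (h hy).1, fun y hy => (h hy).2⟩

/-- A function whose differential vanishes near `x` is constant near `x`. -/
theorem eventually_eq_of_mfderiv_eq_zero {w : M → ℝ} {x : M}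
    (hw : ∀ᶠ y in 𝓝 x, MDifferentiableAt 𝓘(ℝ, E) 𝓘(ℝ, ℝ) w y ∧
      ∀ v : TangentSpace 𝓘(ℝ, E) y, mfderiv 𝓘(ℝ, E) 𝓘(ℝ, ℝ) w y v = (0 : ℝ)) :
    ∀ᶠ y in 𝓝 x, w y = w x := by
  obtain ⟨r, hr, hb, hU⟩ := exists_ball_subset_target (E := E) x hw
  set e := chartAt E x
  have hx := mem_chart_source E x
  have hn : e ⁻¹' Metric.ball (e x) r ∈ 𝓝 x :=
    (e.continuousAt hx) (Metric.ball_mem_nhds _ hr)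
  filter_upwards [hn, e.open_source.mem_nhds hx] with y hy hys
  have hd : DifferentiableOn ℝ (w ∘ e.symm) (Metric.ball (e x) r) := by
    intro z hz
    have := (hU z hz).1.comp z (mdifferentiableAt_chartAt_symm x (hb hz))
    exact (mdifferentiableAt_iff_differentiableAt.1 this).differentiableWithinAt
  have h0 : (Metric.ball (e x) r).EqOn (fderiv ℝ (w ∘ e.symm)) 0 := by
    intro z hz
    ext v
    rw [fderiv_comp_chartAt_symm x (hb hz) (hU z hz).1]
    exact (hU z hz).2 _
  have := Metric.isOpen_ball.is_const_of_fderiv_eq_zero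
    (convex_ball (e x) r).isPreconnected hd h0 hy (Metric.mem_ball_self hr)
  simpa [Function.comp, e.left_inv hx, e.left_inv hys] using this

/-- Two functions with the same differential near `x` differ by a constant near `x`. -/
theorem eventually_sub_eq_of_mfderiv_eq {f g : M → ℝ} {x : M}
    (hf : ∀ᶠ y in 𝓝 x, MDifferentiableAt 𝓘(ℝ, E) 𝓘(ℝ, ℝ) f y)
    (hg : ∀ᶠ y in 𝓝 x, MDifferentiableAt 𝓘(ℝ, E) 𝓘(ℝ, ℝ) g y)
    (h : ∀ᶠ y in 𝓝 x, ∀ v : TangentSpace 𝓘(ℝ, E) y,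
      (mfderiv 𝓘(ℝ, E) 𝓘(ℝ, ℝ) f y v : ℝ) = mfderiv 𝓘(ℝ, E) 𝓘(ℝ, ℝ) g y v) :
    ∀ᶠ y in 𝓝 x, f y - g y = f x - g x := by
  refine eventually_eq_of_mfderiv_eq_zero (E := E) (w := f - g) ?_
  filter_upwards [hf, hg, h] with y h1 h2 h3
  refine ⟨h1.sub h2, fun v => ?_⟩
  rw [mfderiv_sub h1 h2]
  exact sub_eq_zero.2 (h3 v)

end Charts

/-! ### Local primitives of 1-forms and the Poincaré lemma. -/

namespace OneForm

variable {E M : Type*} [NormedAddCommGroup E] [NormedSpace ℝ E]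
    [TopologicalSpace M] [ChartedSpace E M] [IsManifold 𝓘(ℝ, E) ∞ M]

theorem contDiffOn_inChart (θ : OneForm E M) (x₀ : M) (v : E) :
    ContDiffOn ℝ ∞ (fun z => θ.inChart x₀ z v) (chartAt E x₀).target := by
  set e := chartAt E x₀
  have ho : IsOpen e.target := e.open_target
  have h1 : ContMDiffOn 𝓘(ℝ, E) 𝓘(ℝ, E) ∞ e.symm e.target := contMDiffOn_chart_symm
  have h2 := h1.contMDiffOn_tangentMapWithin (m := ∞) (by decide) ho.uniqueMDiffOn
  have h3 : ContMDiffOn 𝓘(ℝ, E) (𝓘(ℝ, E).prod 𝓘(ℝ, E)) ∞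
      (fun z => (⟨z, v⟩ : TangentBundle 𝓘(ℝ, E) E)) e.target := by
    intro z _
    exact contMDiffWithinAt_vectorSpace_iff_contDiffWithinAt.2 contDiffWithinAt_const
  have h4 : ContMDiffOn 𝓘(ℝ, E) (𝓘(ℝ, E).prod 𝓘(ℝ, E)) ∞
      (fun z => Bundle.TotalSpace.mk' E (e.symm z)
        (mfderivWithin 𝓘(ℝ, E) 𝓘(ℝ, E) e.symm e.target z v)) e.target :=
    h2.comp h3 (fun z hz => hz)
  have h5 : ContMDiffOn 𝓘(ℝ, E) (𝓘(ℝ, E).prod 𝓘(ℝ, E →L[ℝ] ℝ)) ∞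
      (fun z => Bundle.TotalSpace.mk' (E →L[ℝ] ℝ)
        (E := fun x : M => TangentSpace 𝓘(ℝ, E) x →L[ℝ] Bundle.Trivial M ℝ x)
        (e.symm z) (θ (e.symm z))) e.target :=
    θ.contMDiff.comp_contMDiffOn h1
  have h6 := h5.clm_bundle_apply h4
  intro y hy
  have h7 := (Bundle.contMDiffWithinAt_totalSpace.1 (h6 y hy)).2
  refine h7.contDiffWithinAt.congr_of_eventuallyEq ?_ ?_
  · filter_upwards [self_mem_nhdsWithin] with z hz
    rw [mfderivWithin_of_isOpen ho hz]
    rfl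
  · rw [mfderivWithin_of_isOpen ho hy]
    rfl

/-- `f` is a smooth primitive of `θ` on a neighbourhood of `x`. -/
def IsPrimitiveAt (θ : OneForm E M) (f : M → ℝ) (x : M) : Prop :=
  ∀ᶠ y in 𝓝 x, ContMDiffAt 𝓘(ℝ, E) 𝓘(ℝ, ℝ) ∞ f y ∧
    ∀ v : TangentSpace 𝓘(ℝ, E) y, θ.evalAt y v = mfderiv 𝓘(ℝ, E) 𝓘(ℝ, ℝ) f y v

/-- All tangent spaces are by definition the model space, so one vector makes sense at both points.
This avoids casts between fibres at propositionally equal points. -/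
theorem evalAt_congr (θ : OneForm E M) {x y : M} (h : x = y) (v : E) :
    θ.evalAt x v = θ.evalAt y v := by
  subst h; rfl

variable {θ η : OneForm E M} {f g : M → ℝ} {x : M}

theorem IsPrimitiveAt.eventually (h : θ.IsPrimitiveAt f x) :
    ∀ᶠ y in 𝓝 x, θ.IsPrimitiveAt f y := eventually_eventually_nhds.2 h

theorem IsPrimitiveAt.contMDiffAt (h : θ.IsPrimitiveAt f x) :
    ContMDiffAt 𝓘(ℝ, E) 𝓘(ℝ, ℝ) ∞ f x := h.self_of_nhds.1

theorem IsPrimitiveAt.congr (h : θ.IsPrimitiveAt f x) (hg : g =ᶠ[𝓝 x] f) :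
    θ.IsPrimitiveAt g x := by
  filter_upwards [h, hg.eventually_nhds] with y hy hgy
  refine ⟨hy.1.congr_of_eventuallyEq hgy, fun v => ?_⟩
  rw [hy.2 v]
  exact congrArg (fun L : E →L[ℝ] ℝ => L v) (Filter.EventuallyEq.mfderiv_eq hgy).symm

theorem IsPrimitiveAt.sub_eventually_eq (hf : θ.IsPrimitiveAt f x) (hg : θ.IsPrimitiveAt g x) :
    ∀ᶠ y in 𝓝 x, f y - g y = f x - g x := by
  refine eventually_sub_eq_of_mfderiv_eq (E := E) ?_ ?_ ?_
  · filter_upwards [hf] with y hy using hy.1.mdifferentiableAt (by decide)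
  · filter_upwards [hg] with y hy using hy.1.mdifferentiableAt (by decide)
  · filter_upwards [hf, hg] with y hy hy' v
    exact (hy.2 v).symm.trans (hy'.2 v)

theorem IsPrimitiveAt.add_const (h : θ.IsPrimitiveAt f x) (c : ℝ) :
    θ.IsPrimitiveAt (fun y => f y + c) x := by
  filter_upwards [h] with y hy
  refine ⟨hy.1.add contMDiffAt_const, fun v => ?_⟩
  have h2 := mfderiv_add (hy.1.mdifferentiableAt (by decide))
    (mdifferentiableAt_const (I := 𝓘(ℝ, E)) (I' := 𝓘(ℝ, ℝ)) (c := c) (x := y))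
  rw [hy.2 v]
  refine Eq.symm ((congrArg (fun L : E →L[ℝ] ℝ => L v) h2).trans ?_)
  rw [mfderiv_const]
  exact add_zero _

theorem IsPrimitiveAt.add (hf : θ.IsPrimitiveAt f x) (hg : η.IsPrimitiveAt g x) :
    (θ + η).IsPrimitiveAt (fun y => f y + g y) x := by
  filter_upwards [hf, hg] with y hy hy'
  refine ⟨hy.1.add hy'.1, fun v => ?_⟩
  have h2 := mfderiv_add (hy.1.mdifferentiableAt (by decide))
    (hy'.1.mdifferentiableAt (by decide))
  refine Eq.symm ((congrArg (fun L : E →L[ℝ] ℝ => L v) h2).trans ?_)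
  exact congrArg₂ (· + ·) (hy.2 v).symm (hy'.2 v).symm

theorem IsPrimitiveAt.smul (c : ℝ) (hf : θ.IsPrimitiveAt f x) :
    (c • θ).IsPrimitiveAt (fun y => c * f y) x := by
  filter_upwards [hf] with y hy
  refine ⟨contMDiffAt_const.mul hy.1, fun v => ?_⟩
  have h2 := const_smul_mfderiv (hy.1.mdifferentiableAt (by decide)) c
  refine Eq.symm ((congrArg (fun L : E →L[ℝ] ℝ => L v) h2).trans ?_)
  exact congrArg (c * ·) (hy.2 v).symm

/-- Poincaré lemma: every point has a path connected neighbourhood on which all closed `1`-forms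
have primitives. -/
theorem exists_nhds_primitive [FiniteDimensional ℝ E] (x : M) :
    ∃ V : Set M, IsOpen V ∧ x ∈ V ∧ IsPathConnected V ∧
      ∀ θ : OneForm E M, θ.IsClosedForm → ∃ f, ∀ y ∈ V, θ.IsPrimitiveAt f y := by
  obtain ⟨r, hr, hb, -⟩ := exists_ball_subset_target (E := E) x univ_mem
  set e := chartAt E x
  set B := Metric.ball (e x) r
  have hx := mem_chart_source E x
  have hV : IsOpen (e.source ∩ e ⁻¹' B) := e.isOpen_inter_preimage Metric.isOpen_ball
  refine ⟨e.source ∩ e ⁻¹' B, hV, ⟨hx, Metric.mem_ball_self hr⟩, ?_, ?_⟩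
  · have h : e.source ∩ e ⁻¹' B = e.symm '' B := by
      rw [e.symm.image_eq_target_inter_inv_preimage hb]; rfl
    rw [h]
    exact ((convex_ball (e x) r).isPathConnected ⟨_, Metric.mem_ball_self hr⟩).image'
      (e.symm.continuousOn.mono hb)
  · intro θ hθ
    let Ω : E → E →L[ℝ] ℝ := fun y =>
      (θ.evalAt (e.symm y)).comp (mfderiv 𝓘(ℝ, E) 𝓘(ℝ, E) e.symm y)
    have hΩ : ContDiffOn ℝ ∞ Ω B :=
      contDiffOn_clm_apply.2 fun v => (θ.contDiffOn_inChart x v).mono hb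
    have hd : DifferentiableOn ℝ Ω B := hΩ.differentiableOn (by decide)
    -- Closedness in the chart is symmetry of the derivative of Ω, which is what integrability on
    -- the convex ball requires.
    have hsymm : ∀ a ∈ B, ∀ u v, fderiv ℝ Ω a u v = fderiv ℝ Ω a v u := by
      intro a ha u v
      have hda : DifferentiableAt ℝ Ω a := hd.differentiableAt (Metric.isOpen_ball.mem_nhds ha)
      have h : ∀ w, fderiv ℝ (fun z => θ.inChart x z w) a = (fderiv ℝ Ω a).flip w := by
        intro w
        have := (hda.hasFDerivAt.clm_apply (hasFDerivAt_const w a)).fderiv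
        refine Eq.trans this ?_
        ext z; simp
      have := hθ x a (hb ha) u v
      rw [h, h] at this
      exact sub_eq_zero.1 this
    obtain ⟨f₀, hf₀⟩ := (convex_ball (e x) r).exists_forall_hasFDerivAt_of_fderiv_symmetric
      Metric.isOpen_ball hd hsymm
    have hf₀s : ContDiffOn ℝ ∞ f₀ B := by
      rw [contDiffOn_infty_iff_fderiv_of_isOpen Metric.isOpen_ball]
      exact ⟨fun a ha => (hf₀ a ha).differentiableAt.differentiableWithinAt,
        hΩ.congr fun a ha => (hf₀ a ha).fderiv⟩
    refine ⟨f₀ ∘ e, fun y hy => ?_⟩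
    filter_upwards [hV.mem_nhds hy] with z hz
    have hfz := hf₀s.contDiffAt (Metric.isOpen_ball.mem_nhds hz.2)
    refine ⟨hfz.contMDiffAt.comp z ((contMDiffOn_chart (I := 𝓘(ℝ, E))).contMDiffAt
      (e.open_source.mem_nhds hz.1)), fun v => ?_⟩
    have h1 := mfderiv_comp z (I' := 𝓘(ℝ, E)) (I'' := 𝓘(ℝ, ℝ)) (g := f₀)
      (hfz.differentiableAt (by decide)).mdifferentiableAt (mdifferentiableAt_chartAt x hz.1)
    refine Eq.symm ((congrArg (fun L : E →L[ℝ] ℝ => L v) h1).trans ?_)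
    rw [mfderiv_eq_fderiv, (hf₀ _ hz.2).fderiv]
    refine (θ.evalAt_congr (e.left_inv hz.1) _).trans ?_
    exact congrArg (θ.evalAt z) (mfderiv_chartAt_symm_mfderiv_chartAt x hz.1 v)

end OneForm

/-! ### Integration of closed forms along continuous paths -/

/-- On a bounded convex set every local additive cocycle is a coboundary. -/
theorem Convex.exists_sub_eq_of_local_cocycle {V : Type*} [NormedAddCommGroup V] [NormedSpace ℝ V]
    {K : Set V} (hK : Convex ℝ K) (hb : Bornology.IsBounded K) {δ : ℝ} (hδ : 0 < δ) (D : K → K → ℝ)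
    (hD : ∀ x y z : K, dist x y < δ → dist y z < δ → dist x z < δ → D x y + D y z = D x z) :
    ∃ F : K → ℝ, ∃ ε > 0, ∀ x y : K, dist x y < ε → F y - F x = D x y := by
  rcases K.eq_empty_or_nonempty with rfl | ⟨x₀, hx₀⟩
  · exact ⟨fun _ => 0, 1, one_pos, fun x => x.2.elim⟩
  obtain ⟨R, hR⟩ := Metric.isBounded_iff.1 hb
  obtain ⟨N, hN⟩ := exists_nat_gt (R / (δ / 4))
  have hR0 : 0 ≤ R := dist_nonneg.trans (hR hx₀ hx₀)
  have hN0 : (0 : ℝ) < N := (div_nonneg hR0 (by positivity)).trans_lt hN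
  rw [div_lt_iff₀ (by positivity)] at hN
  -- The points `p x k` subdivide the segment from x₀ to x into N steps shorter than δ/4. Truncation
  -- at 1 keeps them in K for every k, so no bound on k has to be carried along.
  let t : ℕ → ℝ := fun k => min 1 (k / N)
  have ht : ∀ k, t k ∈ Icc (0 : ℝ) 1 := fun k => ⟨le_min zero_le_one (by positivity), min_le_left _ _⟩
  let p : K → ℕ → K := fun x k => ⟨AffineMap.lineMap x₀ (x : V) (t k), hK.lineMap_mem hx₀ x.2 (ht k)⟩
  have hp0 : ∀ x, p x 0 = ⟨x₀, hx₀⟩ := fun x => Subtype.ext (by simp [p, t])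
  have hpN : ∀ x, p x N = x := fun x => Subtype.ext (by simp [p, t, div_self hN0.ne'])
  have htt : ∀ k, dist (t k) (t (k + 1)) ≤ 1 / N := by
    intro k
    have h := abs_min_sub_min_le_max 1 ((k : ℝ) / N) 1 (((k + 1 : ℕ) : ℝ) / N)
    rw [Real.dist_eq]
    refine h.trans ?_
    rw [sub_self, abs_zero, ← sub_div, abs_div, abs_of_pos hN0]
    push_cast
    simp
  have hd1 : ∀ x k, dist (p x k) (p x (k + 1)) < δ / 4 := by
    intro x k
    have h : dist (p x k) (p x (k + 1)) = dist (t k) (t (k + 1)) * dist x₀ (x : V) :=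
      dist_lineMap_lineMap x₀ (x : V) (t k) (t (k + 1))
    rw [h]
    calc _ ≤ 1 / N * R := mul_le_mul (htt k) (hR hx₀ x.2) dist_nonneg (by positivity)
      _ < δ / 4 := by rw [one_div, inv_mul_lt_iff₀ hN0]; exact hN
  have hd2 : ∀ x y k, dist (p x k) (p y k) ≤ dist x y := by
    intro x y k
    have h : dist (p x k) (p y k) = ‖t k‖ * dist (x : V) y := by
      change dist (AffineMap.lineMap x₀ (x : V) (t k)) (AffineMap.lineMap x₀ (y : V) (t k)) = _
      rw [dist_eq_norm, dist_eq_norm, ← norm_smul]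
      congr 1
      simp only [AffineMap.lineMap_apply, vsub_eq_sub, vadd_eq_add]
      module
    rw [h, Real.norm_of_nonneg (ht k).1]
    exact mul_le_of_le_one_left dist_nonneg (ht k).2
  refine ⟨fun x => ∑ k ∈ Finset.range N, D (p x k) (p x (k + 1)), δ / 4, by positivity,
    fun x y hxy => ?_⟩
  -- Ladder between the segments to x and to y: each cell consists of two small triangles, and the
  -- cocycle identity on both moves the rung from k to k + 1.
  have key : ∀ k, ∑ i ∈ Finset.range k, D (p y i) (p y (i + 1)) -
      ∑ i ∈ Finset.range k, D (p x i) (p x (i + 1)) = D (p x k) (p y k) := by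
    intro k
    induction k with
    | zero =>
      -- The identity at a constant triple gives `D x₀ x₀ = 0`.
      have := hD ⟨x₀, hx₀⟩ ⟨x₀, hx₀⟩ ⟨x₀, hx₀⟩ (by simpa) (by simpa) (by simpa)
      rw [hp0, hp0]; simp; linarith
    | succ k ih =>
      have a1 := (hd2 x y k).trans_lt hxy
      have a2 := (hd2 x y (k + 1)).trans_lt hxy
      have a3 := hd1 x k
      have a4 := hd1 y k
      have a5 := dist_triangle (p x k) (p y k) (p y (k + 1))
      have h1 := hD (p x k) (p y k) (p y (k + 1)) (by linarith) (by linarith) (by linarith)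
      have h2 := hD (p x k) (p x (k + 1)) (p y (k + 1)) (by linarith) (by linarith) (by linarith)
      rw [Finset.sum_range_succ, Finset.sum_range_succ]
      linarith
  have := key N
  rwa [hpN, hpN] at this

namespace OneForm

variable {E M : Type*} [NormedAddCommGroup E] [NormedSpace ℝ E]
    [TopologicalSpace M] [ChartedSpace E M] [IsManifold 𝓘(ℝ, E) ∞ M]

/-- `F` is a primitive of the pull-back of `θ` under `φ`: it differs by locally constant functions
from the pull-backs of the primitives of `θ`. -/
def IsPrimitiveAlong {X : Type*} [TopologicalSpace X] (θ : OneForm E M) (φ : X → M) (F : X → ℝ) :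
    Prop :=
  ∀ x f, θ.IsPrimitiveAt f (φ x) → ∀ᶠ y in 𝓝 x, F y - F x = f (φ y) - f (φ x)

section

variable {X Y : Type*} [TopologicalSpace X] [TopologicalSpace Y] {θ η : OneForm E M} {φ : X → M}
  {F F' : X → ℝ}

/-- Two local primitives differ by a locally constant function, so testing against one of them at
each point is enough. -/
theorem isPrimitiveAlong_of_exists (hφ : Continuous φ)
    (h : ∀ x, ∃ f, θ.IsPrimitiveAt f (φ x) ∧ ∀ᶠ y in 𝓝 x, F y - F x = f (φ y) - f (φ x)) :
    θ.IsPrimitiveAlong φ F := by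
  intro x f hf
  obtain ⟨g, hg, hF⟩ := h x
  filter_upwards [hF, hφ.continuousAt.eventually (hf.sub_eventually_eq hg)] with y h1 h2
  linarith

theorem IsPrimitiveAlong.comp (h : θ.IsPrimitiveAlong φ F) {ι : Y → X} (hι : Continuous ι) :
    θ.IsPrimitiveAlong (φ ∘ ι) (F ∘ ι) := fun x f hf =>
  hι.continuousAt.eventually (h (ι x) f hf)

variable [FiniteDimensional ℝ E]

theorem IsClosedForm.exists_primitiveAt (hθ : θ.IsClosedForm) (x : M) :
    ∃ f, θ.IsPrimitiveAt f x := by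
  obtain ⟨V, -, hx, -, h⟩ := exists_nhds_primitive (E := E) x
  obtain ⟨f, hf⟩ := h θ hθ
  exact ⟨f, hf x hx⟩

/-- The difference of two primitives along φ is locally constant. Hence increments do not depend on
the choice made in `pathIntegral`. -/
theorem IsPrimitiveAlong.sub_eq_sub [PreconnectedSpace X] (hθ : θ.IsClosedForm)
    (h : θ.IsPrimitiveAlong φ F) (h' : θ.IsPrimitiveAlong φ F') (x y : X) :
    F y - F x = F' y - F' x := by
  have := isPreconnected_univ.eq_of_eventually_eq (w := F - F') (fun x _ => by
    obtain ⟨f, hf⟩ := hθ.exists_primitiveAt (φ x)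
    rw [nhdsWithin_univ]
    filter_upwards [h x f hf, h' x f hf] with y h1 h2
    simp only [Pi.sub_apply]
    linarith) (mem_univ x) (mem_univ y)
  simp only [Pi.sub_apply] at this
  linarith

theorem IsPrimitiveAlong.add (hθ : θ.IsClosedForm) (hη : η.IsClosedForm) (hφ : Continuous φ)
    (h : θ.IsPrimitiveAlong φ F) (h' : η.IsPrimitiveAlong φ F') :
    (θ + η).IsPrimitiveAlong φ (fun x => F x + F' x) := by
  refine isPrimitiveAlong_of_exists hφ fun x => ?_
  obtain ⟨f, hf⟩ := hθ.exists_primitiveAt (φ x)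
  obtain ⟨g, hg⟩ := hη.exists_primitiveAt (φ x)
  refine ⟨_, hf.add hg, ?_⟩
  filter_upwards [h x f hf, h' x g hg] with y h1 h2
  linarith

theorem IsPrimitiveAlong.smul (hθ : θ.IsClosedForm) (hφ : Continuous φ)
    (h : θ.IsPrimitiveAlong φ F) (c : ℝ) :
    (c • θ).IsPrimitiveAlong φ (fun x => c * F x) := by
  refine isPrimitiveAlong_of_exists hφ fun x => ?_
  obtain ⟨f, hf⟩ := hθ.exists_primitiveAt (φ x)
  refine ⟨_, hf.smul c, ?_⟩
  filter_upwards [h x f hf] with y h1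
  rw [← mul_sub, ← mul_sub, h1]

/-- The pull-back of a closed form to a compact convex set has a primitive. -/
theorem IsClosedForm.exists_primitiveAlong {V : Type*} [NormedAddCommGroup V] [NormedSpace ℝ V]
    {K : Set V} (hK : Convex ℝ K) (hc : IsCompact K) (hθ : θ.IsClosedForm) {φ : K → M}
    (hφ : Continuous φ) : ∃ F, θ.IsPrimitiveAlong φ F := by
  choose U hUo hxU _ hU using exists_nhds_primitive (E := E) (M := M)
  choose f hf using fun x => hU x θ hθ
  have : CompactSpace K := isCompact_iff_compactSpace.1 hc
  obtain ⟨δ, hδ, hleb⟩ := lebesgue_number_lemma_of_metric (s := (univ : Set K)) isCompact_univ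
    (c := fun p => φ ⁻¹' U p) (fun p => (hUo p).preimage hφ)
    (fun x _ => mem_iUnion.2 ⟨φ x, hxU (φ x)⟩)
  choose p hp using fun x => hleb x (mem_univ x)
  obtain ⟨F, ε, hε, hF⟩ := hK.exists_sub_eq_of_local_cocycle hc.isBounded hδ
    (fun x y => f (p x) (φ y) - f (p x) (φ x)) (by
      intro x y z hxy hyz hxz
      -- The cocycle identity says that the primitives chosen for x and for y differ by the same
      -- amount at y and at z. Both points lie in an overlap of balls of K, which is convex.
      have hS : IsPreconnected (Metric.ball x δ ∩ Metric.ball y δ) := by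
        rw [← Topology.IsInducing.subtypeVal.isPreconnected_image]
        have : Subtype.val '' (Metric.ball x δ ∩ Metric.ball y δ) =
            K ∩ (Metric.ball (x : V) δ ∩ Metric.ball (y : V) δ) := by
          ext z
          simp only [mem_image, Subtype.exists, mem_inter_iff, Metric.mem_ball, Subtype.dist_eq]
          constructor
          · rintro ⟨a, ha, h, rfl⟩; exact ⟨ha, h⟩
          · rintro ⟨h, h'⟩; exact ⟨z, h, h', rfl⟩
        rw [this]
        exact (hK.inter ((convex_ball _ _).inter (convex_ball _ _))).isPreconnected
      have := hS.eq_of_eventually_eq (w := fun w => f (p x) (φ w) - f (p y) (φ w))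
        (fun w hw => mem_nhdsWithin_of_mem_nhds (hφ.continuousAt.eventually
          ((hf _ _ (hp x hw.1)).sub_eventually_eq (hf _ _ (hp y hw.2)))))
        (x := y) (y := z) ⟨by rwa [Metric.mem_ball'], Metric.mem_ball_self hδ⟩
        ⟨by rwa [Metric.mem_ball'], by rwa [Metric.mem_ball']⟩
      linarith)
  refine ⟨F, isPrimitiveAlong_of_exists hφ fun x =>
    ⟨f (p x), hf _ _ (hp x (Metric.mem_ball_self hδ)), ?_⟩⟩
  filter_upwards [Metric.ball_mem_nhds x hε] with y hy
  exact hF x y (by rwa [Metric.mem_ball'] at hy)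

end

open Classical in
/-- The integral of a closed form along a continuous path. -/
def pathIntegral (θ : OneForm E M) (γ : C(unitInterval, M)) : ℝ :=
  if h : ∃ F, θ.IsPrimitiveAlong γ F then h.choose 1 - h.choose 0 else 0

variable [FiniteDimensional ℝ E] {θ η : OneForm E M}

theorem IsPrimitiveAlong.pathIntegral_eq (hθ : θ.IsClosedForm) {γ : C(unitInterval, M)}
    {F : unitInterval → ℝ} (h : θ.IsPrimitiveAlong γ F) : θ.pathIntegral γ = F 1 - F 0 := by
  have h' : ∃ F, θ.IsPrimitiveAlong γ F := ⟨F, h⟩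
  rw [pathIntegral, dif_pos h']
  exact h'.choose_spec.sub_eq_sub hθ h 0 1

theorem IsClosedForm.exists_primitiveAlong_path (hθ : θ.IsClosedForm) (γ : C(unitInterval, M)) :
    ∃ F, θ.IsPrimitiveAlong γ F :=
  hθ.exists_primitiveAlong (convex_Icc 0 1) isCompact_Icc γ.continuous

theorem pathIntegral_add (hθ : θ.IsClosedForm) (hη : η.IsClosedForm) (hs : (θ + η).IsClosedForm)
    (γ : C(unitInterval, M)) :
    (θ + η).pathIntegral γ = θ.pathIntegral γ + η.pathIntegral γ := by
  obtain ⟨F, hF⟩ := hθ.exists_primitiveAlong_path γ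
  obtain ⟨F', hF'⟩ := hη.exists_primitiveAlong_path γ
  rw [hF.pathIntegral_eq hθ, hF'.pathIntegral_eq hη,
    (hF.add hθ hη γ.continuous hF').pathIntegral_eq hs]
  ring

theorem pathIntegral_smul (hθ : θ.IsClosedForm) (c : ℝ) (hs : (c • θ).IsClosedForm)
    (γ : C(unitInterval, M)) : (c • θ).pathIntegral γ = c * θ.pathIntegral γ := by
  obtain ⟨F, hF⟩ := hθ.exists_primitiveAlong_path γ
  rw [hF.pathIntegral_eq hθ, (hF.smul hθ γ.continuous c).pathIntegral_eq hs]
  ring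

/-- Along a path on which `θ` has the primitive `f`, the integral is the increment of `f`. -/
theorem pathIntegral_eq_of_isPrimitiveAt (hθ : θ.IsClosedForm) {γ : C(unitInterval, M)} {f : M → ℝ}
    (hf : ∀ r, θ.IsPrimitiveAt f (γ r)) : θ.pathIntegral γ = f (γ 1) - f (γ 0) :=
  IsPrimitiveAlong.pathIntegral_eq (F := f ∘ γ) hθ
    (isPrimitiveAlong_of_exists γ.continuous fun r => ⟨f, hf r, Eventually.of_forall fun _ => rfl⟩)

/-- For smooth paths, the integral is given by the usual formula. -/
theorem pathIntegral_eq_intervalIntegral (hθ : θ.IsClosedForm) {γ : ℝ → M}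
    (hγ : ContMDiffOn 𝓘(ℝ, ℝ) 𝓘(ℝ, E) ∞ γ (Icc 0 1)) {c : C(unitInterval, M)}
    (hc : ∀ r, c r = γ r) :
    θ.pathIntegral c = ∫ r in (0 : ℝ)..1,
      θ.evalAt (γ r) (mfderivWithin 𝓘(ℝ, ℝ) 𝓘(ℝ, E) γ (Icc 0 1) r (1 : ℝ)) := by
  obtain ⟨F, hF⟩ := hθ.exists_primitiveAlong_path c
  set g : ℝ → ℝ := fun r => θ.evalAt (γ r) (mfderivWithin 𝓘(ℝ, ℝ) 𝓘(ℝ, E) γ (Icc 0 1) r (1 : ℝ))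
    with hg
  set F' : ℝ → ℝ := IccExtend zero_le_one F
  have hu : UniqueDiffOn ℝ (Icc (0 : ℝ) 1) := uniqueDiffOn_Icc zero_lt_one
  -- Near r the function F' is f ∘ γ plus a constant, for a local primitive f. This gives its
  -- derivative, and continuity of the integrand follows from smoothness of f ∘ γ.
  have key : ∀ r ∈ Icc (0 : ℝ) 1, HasDerivWithinAt F' (g r) (Icc 0 1) r ∧
      ContinuousWithinAt g (Icc 0 1) r := by
    intro r hr
    obtain ⟨f, hf⟩ := hθ.exists_primitiveAt (γ r)
    have hγc : Tendsto γ (𝓝[Icc 0 1] r) (𝓝 (γ r)) := hγ.continuousOn r hr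
    have hder : ∀ s ∈ Icc (0 : ℝ) 1, θ.IsPrimitiveAt f (γ s) →
        HasDerivWithinAt (f ∘ γ) (g s) (Icc 0 1) s := by
      intro s hs hfs
      have h1 := (hfs.contMDiffAt.mdifferentiableAt (by decide)).hasMFDerivAt
      have h2 := ((hγ s hs).mdifferentiableWithinAt (by decide)).hasMFDerivWithinAt
      let A : E →L[ℝ] ℝ := mfderiv 𝓘(ℝ, E) 𝓘(ℝ, ℝ) f (γ s)
      let B : ℝ →L[ℝ] E := mfderivWithin 𝓘(ℝ, ℝ) 𝓘(ℝ, E) γ (Icc 0 1) s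
      have h3 : HasFDerivWithinAt (f ∘ γ) (A.comp B) (Icc 0 1) s :=
        (h1.comp_hasMFDerivWithinAt s h2).hasFDerivWithinAt
      have h4 : g s = A.comp B 1 := hfs.self_of_nhds.2 _
      rw [h4]
      exact h3.hasDerivWithinAt
    have hsm : ContDiffWithinAt ℝ ∞ (f ∘ γ) (Icc 0 1) r :=
      (hf.contMDiffAt.comp_contMDiffWithinAt r (hγ r hr)).contDiffWithinAt
    have hfe : F' =ᶠ[𝓝[Icc 0 1] r] fun s => (f ∘ γ) s + (F' r - f (γ r)) := by
      rw [nhdsWithin_eq_map_subtype_coe hr]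
      have := hF ⟨r, hr⟩ f (by rw [hc]; exact hf)
      refine (eventually_map.2 ?_ : ∀ᶠ _ in map _ _, _)
      filter_upwards [this] with s hs
      rw [hc, hc] at hs
      have e1 : F' s = F s := IccExtend_val _ _ _
      have e2 : F' r = F ⟨r, hr⟩ := IccExtend_of_mem _ _ hr
      rw [e1, e2]
      simp only [Function.comp]
      linarith
    refine ⟨?_, ?_⟩
    · exact ((hder r hr hf).add_const _).congr_of_eventuallyEq_of_mem hfe hr
    · have h1 := (hsm.fderivWithin_right hu (m := 0) (by decide) hr).continuousWithinAt.clm_apply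
        (continuousWithinAt_const (b := (1 : ℝ)))
      refine h1.congr_of_eventuallyEq_of_mem ?_ hr
      filter_upwards [hγc.eventually hf.eventually, self_mem_nhdsWithin] with s hs hs'
      exact ((hder s hs' hs).derivWithin (hu s hs')).symm
  have h := intervalIntegral.integral_eq_sub_of_hasDerivAt_of_le (f := F') (f' := g) zero_le_one
    (fun r hr => (key r hr).1.continuousWithinAt)
    (fun r hr => (key r (Ioo_subset_Icc_self hr)).1.hasDerivAt (Icc_mem_nhds hr.1 hr.2))
    (ContinuousOn.intervalIntegrable (by
      rw [uIcc_of_le zero_le_one]; exact fun r hr => (key r hr).2))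
  rw [h, hF.pathIntegral_eq hθ]
  congr 1
  · exact (IccExtend_right _ _).symm
  · exact (IccExtend_left _ _).symm

end OneForm

/-! ### Periods -/

namespace SingularChains

theorem edge_zero (i j : Fin 3) :
    edge i j 0 = ⟨Pi.single i 1, single_mem_stdSimplex ℝ i⟩ := by
  apply Subtype.ext
  simp [edge]

theorem edge_one (i j : Fin 3) :
    edge i j 1 = ⟨Pi.single j 1, single_mem_stdSimplex ℝ j⟩ := by
  apply Subtype.ext
  simp [edge]

end SingularChains

namespace LieGroupoid

open SingularChains

variable {E F M G : Type*}
    [NormedAddCommGroup E] [NormedSpace ℝ E] [NormedAddCommGroup F] [NormedSpace ℝ F]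
    [TopologicalSpace M] [ChartedSpace E M] [IsManifold 𝓘(ℝ, E) ∞ M]
    [TopologicalSpace G] [ChartedSpace F G]
    {𝒢 : LieGroupoid E F M G} {θ η : OneForm E M}

/-- The primitives of a basic form are locally invariant up to constants. -/
theorem IsBasicForm.eventually_sub_eq [IsManifold 𝓘(ℝ, F) ∞ G] (hb : 𝒢.IsBasicForm θ) {g : G}
    {f f' : M → ℝ} (hf : θ.IsPrimitiveAt f (𝒢.tgt g)) (hf' : θ.IsPrimitiveAt f' (𝒢.src g)) :
    ∀ᶠ h in 𝓝 g, f (𝒢.tgt h) - f' (𝒢.src h) = f (𝒢.tgt g) - f' (𝒢.src g) := by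
  have ht := 𝒢.contMDiff_tgt.continuous.continuousAt.eventually hf
  have hs := 𝒢.contMDiff_src.continuous.continuousAt.eventually hf'
  have dt : ∀ h, MDifferentiableAt 𝓘(ℝ, F) 𝓘(ℝ, E) 𝒢.tgt h := fun h =>
    𝒢.contMDiff_tgt.mdifferentiableAt (by decide)
  have ds : ∀ h, MDifferentiableAt 𝓘(ℝ, F) 𝓘(ℝ, E) 𝒢.src h := fun h =>
    𝒢.contMDiff_src.mdifferentiableAt (by decide)
  refine eventually_sub_eq_of_mfderiv_eq (E := F) (f := f ∘ 𝒢.tgt) (g := f' ∘ 𝒢.src) ?_ ?_ ?_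
  · filter_upwards [ht] with h h1 using (h1.1.mdifferentiableAt (by decide)).comp h (dt h)
  · filter_upwards [hs] with h h1 using (h1.1.mdifferentiableAt (by decide)).comp h (ds h)
  · filter_upwards [ht, hs] with h h1 h2 v
    have e1 := mfderiv_comp h (h1.1.mdifferentiableAt (by decide)) (dt h)
    have e2 := mfderiv_comp h (h2.1.mdifferentiableAt (by decide)) (ds h)
    refine (congrArg (fun L : F →L[ℝ] ℝ => L v) e1).trans
      (Eq.trans ?_ (congrArg (fun L : F →L[ℝ] ℝ => L v) e2).symm)
    exact (h1.2 _).symm.trans ((hb h v).symm.trans (h2.2 _))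

/-- `q` is a possibly discontinuous primitive of `θ` modulo the subgroup `Q` of `ℝ`, invariant
modulo `Q`. -/
def IsPrimitiveModulo (𝒢 : LieGroupoid E F M G) (θ : OneForm E M) (Q : AddSubgroup ℝ)
    (q : M → ℝ) : Prop :=
  (∀ x, ∃ f, θ.IsPrimitiveAt f x ∧ ∀ᶠ y in 𝓝 x, f y - q y ∈ Q) ∧
    ∀ g, q (𝒢.tgt g) - q (𝒢.src g) ∈ Q

theorem IsPrimitiveModulo.add {Q : AddSubgroup ℝ} {q r : M → ℝ} (h : 𝒢.IsPrimitiveModulo θ Q q)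
    (h' : 𝒢.IsPrimitiveModulo η Q r) : 𝒢.IsPrimitiveModulo (θ + η) Q (fun x => q x + r x) := by
  refine ⟨fun x => ?_, fun g => ?_⟩
  · obtain ⟨f, hf, hq⟩ := h.1 x
    obtain ⟨f', hf', hq'⟩ := h'.1 x
    refine ⟨_, hf.add hf', ?_⟩
    filter_upwards [hq, hq'] with y h1 h2
    rw [add_sub_add_comm]
    exact Q.add_mem h1 h2
  · rw [add_sub_add_comm]
    exact Q.add_mem (h.2 g) (h'.2 g)

/-- The target subgroup may differ from Q. In the application both are ℚ and c is rational. -/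
theorem IsPrimitiveModulo.smul {Q Q' : AddSubgroup ℝ} {q : M → ℝ}
    (h : 𝒢.IsPrimitiveModulo θ Q q) {c : ℝ} (hc : ∀ a ∈ Q, c * a ∈ Q') :
    𝒢.IsPrimitiveModulo (c • θ) Q' (fun x => c * q x) := by
  refine ⟨fun x => ?_, fun g => ?_⟩
  · obtain ⟨f, hf, hq⟩ := h.1 x
    refine ⟨_, hf.smul c, ?_⟩
    filter_upwards [hq] with y h1
    rw [← mul_sub]
    exact hc _ h1
  · rw [← mul_sub]
    exact hc _ (h.2 g)

/-- A form with an invariant primitive is the differential of a basic function. -/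
theorem IsPrimitiveModulo.isBasicFunction {q : M → ℝ} (h : 𝒢.IsPrimitiveModulo θ ⊥ q) :
    𝒢.IsBasicFunction q ∧ θ.IsDifferentialOf q := by
  have hq : ∀ x, θ.IsPrimitiveAt q x := by
    intro x
    obtain ⟨f, hf, hq⟩ := h.1 x
    refine hf.congr ?_
    filter_upwards [hq] with y hy
    exact (sub_eq_zero.1 (AddSubgroup.mem_bot.1 hy)).symm
  exact ⟨⟨fun x => (hq x).contMDiffAt,
    fun g => (sub_eq_zero.1 (AddSubgroup.mem_bot.1 (h.2 g))).symm⟩,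
    fun x => (hq x).self_of_nhds.2⟩

theorem IsPrimitiveModulo.mem_exactBasicForms {θ : 𝒢.closedBasicForms} {q : M → ℝ}
    (h : 𝒢.IsPrimitiveModulo (θ : OneForm E M) ⊥ q) : θ ∈ 𝒢.exactBasicForms :=
  ⟨q, h.isBasicFunction⟩

theorem exists_isPrimitiveModulo_bot {θ : 𝒢.closedBasicForms} (h : θ ∈ 𝒢.exactBasicForms) :
    ∃ q, 𝒢.IsPrimitiveModulo (θ : OneForm E M) ⊥ q := by
  obtain ⟨q, hq, hd⟩ := h
  exact ⟨q, fun x => ⟨q, Eventually.of_forall fun y => ⟨hq.1 y, hd y⟩,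
    Eventually.of_forall fun y => AddSubgroup.mem_bot.2 (sub_self _)⟩,
    fun g => AddSubgroup.mem_bot.2 (sub_eq_zero.2 (hq.2 g).symm)⟩

variable (𝒢) in
/-- The integral of a form over total singular `1`-chains; arrows do not contribute. -/
def chainIntegral (θ : OneForm E M) : 𝒢.Chain1 →ₗ[ℤ] ℝ :=
  LinearMap.coprod 0 (Finsupp.linearCombination ℤ θ.pathIntegral)

@[simp]
theorem chainIntegral_arrowChain (g : G) : 𝒢.chainIntegral θ (𝒢.arrowChain g) = 0 := by
  simp [chainIntegral, arrowChain]

@[simp]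
theorem chainIntegral_pathChain (γ : C(unitInterval, M)) :
    𝒢.chainIntegral θ (𝒢.pathChain γ) = θ.pathIntegral γ := by
  simp [chainIntegral, pathChain]

omit [IsManifold 𝓘(ℝ, E) ∞ M] in
theorem boundary1_arrowChain (g : G) : 𝒢.boundary1 (𝒢.arrowChain g) =
    Finsupp.single (𝒢.src g) (1 : ℤ) - Finsupp.single (𝒢.tgt g) 1 := by
  simp [boundary1, arrowChain]

omit [IsManifold 𝓘(ℝ, E) ∞ M] in
theorem boundary1_pathChain (γ : C(unitInterval, M)) : 𝒢.boundary1 (𝒢.pathChain γ) =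
    Finsupp.single (γ 0) (1 : ℤ) - Finsupp.single (γ 1) 1 := by
  simp [boundary1, pathChain]

omit [IsManifold 𝓘(ℝ, E) ∞ M] in
theorem chain1_hom_ext {A : Type*} [AddCommGroup A] {φ ψ : 𝒢.Chain1 →ₗ[ℤ] A}
    (h1 : ∀ g, φ (𝒢.arrowChain g) = ψ (𝒢.arrowChain g))
    (h2 : ∀ γ, φ (𝒢.pathChain γ) = ψ (𝒢.pathChain γ)) : φ = ψ := by
  refine LinearMap.prod_ext (Finsupp.lhom_ext' fun g => ?_) (Finsupp.lhom_ext' fun γ => ?_)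
  · ext; exact h1 g
  · ext; exact h2 γ

/-! ### Integrals of closed basic forms vanish on boundaries. -/

section

variable [FiniteDimensional ℝ E]

/-- Local primitives at the source and at the target of the moving arrow differ by locally constant
amounts, so one function is a primitive along both paths. -/
theorem IsBasicForm.pathIntegral_tgtPath [IsManifold 𝓘(ℝ, F) ∞ G] (hθ : θ.IsClosedForm)
    (hb : 𝒢.IsBasicForm θ) (τ : C(unitInterval, G)) :
    θ.pathIntegral (𝒢.tgtPath τ) = θ.pathIntegral (𝒢.srcPath τ) := by
  obtain ⟨P, hP⟩ := hθ.exists_primitiveAlong_path (𝒢.srcPath τ)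
  have hP' : θ.IsPrimitiveAlong (𝒢.tgtPath τ) P := by
    intro r f hf
    obtain ⟨f', hf'⟩ := hθ.exists_primitiveAt (𝒢.srcPath τ r)
    filter_upwards [hP r f' hf', τ.continuous.continuousAt.eventually
      (hb.eventually_sub_eq (g := τ r) hf hf')] with s h1 h2
    change P s - P r = f (𝒢.tgt (τ s)) - f (𝒢.tgt (τ r))
    change P s - P r = f' (𝒢.src (τ s)) - f' (𝒢.src (τ r)) at h1
    linarith
  rw [hP.pathIntegral_eq hθ, hP'.pathIntegral_eq hθ]

/-- One primitive on the whole compact convex triangle restricts to all three edges, and its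
increments cancel. -/
theorem pathIntegral_boundary_triangle (hθ : θ.IsClosedForm) (κ : C(Triangle, M)) :
    θ.pathIntegral (κ.comp (edge 1 2)) - θ.pathIntegral (κ.comp (edge 0 2))
      + θ.pathIntegral (κ.comp (edge 0 1)) = 0 := by
  obtain ⟨P, hP⟩ := hθ.exists_primitiveAlong (convex_stdSimplex ℝ (Fin 3))
    (isCompact_stdSimplex ℝ (Fin 3)) κ.continuous
  have h : ∀ i j, θ.pathIntegral (κ.comp (edge i j)) = P (edge i j 1) - P (edge i j 0) :=
    fun i j => OneForm.IsPrimitiveAlong.pathIntegral_eq (F := P ∘ edge i j) hθ (hP.comp (edge i j).continuous)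
  simp only [h, edge_zero, edge_one]
  ring

variable [IsManifold 𝓘(ℝ, F) ∞ G]

theorem chainIntegral_comp_boundary2 (θ : 𝒢.closedBasicForms) :
    𝒢.chainIntegral (θ : OneForm E M) ∘ₗ 𝒢.boundary2 = 0 := by
  obtain ⟨θ, hθ, hb⟩ := θ
  refine LinearMap.prod_ext (Finsupp.lhom_ext' fun p => ?_)
    (LinearMap.prod_ext (Finsupp.lhom_ext' fun τ => ?_) (Finsupp.lhom_ext' fun κ => ?_))
  · ext; simp [boundary2]
  · ext; simp [boundary2, hb.pathIntegral_tgtPath hθ]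
  · ext; simpa [boundary2] using pathIntegral_boundary_triangle hθ κ

/-- The homomorphism of periods of a closed basic form. -/
def periodHom (θ : 𝒢.closedBasicForms) : 𝒢.H1 →ₗ[ℤ] ℝ :=
  Submodule.liftQ _ (𝒢.chainIntegral (θ : OneForm E M) ∘ₗ 𝒢.Cycle1.subtype) (by
    rintro ⟨z, hz⟩ ⟨w, rfl⟩
    exact LinearMap.congr_fun (chainIntegral_comp_boundary2 θ) w)

end

/-! ### Periods modulo a subgroup, and exactness of forms without periods. -/

section

variable [FiniteDimensional ℝ E]

/-- For a primitive P along γ, the class of P - q ∘ γ in ℝ/Q is locally constant on the interval,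
hence constant, however irregular q may be. -/
theorem IsPrimitiveModulo.pathIntegral_mem (hθ : θ.IsClosedForm) {Q : AddSubgroup ℝ} {q : M → ℝ}
    (h : 𝒢.IsPrimitiveModulo θ Q q) (γ : C(unitInterval, M)) :
    θ.pathIntegral γ + (q (γ 0) - q (γ 1)) ∈ Q := by
  obtain ⟨P, hP⟩ := hθ.exists_primitiveAlong_path γ
  rw [hP.pathIntegral_eq hθ]
  have := isPreconnected_univ.eq_of_eventually_eq
    (w := fun r => ((P r - q (γ r) : ℝ) : ℝ ⧸ Q)) (fun r _ => by
      obtain ⟨f, hf, hq⟩ := h.1 (γ r)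
      rw [nhdsWithin_univ]
      filter_upwards [hP r f hf, γ.continuous.continuousAt.eventually hq] with s h1 h2
      rw [QuotientAddGroup.eq]
      have h3 := hq.self_of_nhds
      have : -(P s - q (γ s)) + (P r - q (γ r)) = (f (γ r) - q (γ r)) - (f (γ s) - q (γ s)) := by
        linarith
      rw [this]
      exact Q.sub_mem h3 h2) (mem_univ (0 : unitInterval)) (mem_univ 1)
  rw [QuotientAddGroup.eq] at this
  convert this using 1
  ring

/-- Modulo `Q`, the integral over a chain only depends on the boundary of the chain. -/
theorem IsPrimitiveModulo.chainIntegral_mem (hθ : θ.IsClosedForm) {Q : AddSubgroup ℝ} {q : M → ℝ}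
    (h : 𝒢.IsPrimitiveModulo θ Q q) (z : 𝒢.Chain1) (hz : z ∈ 𝒢.Cycle1) :
    𝒢.chainIntegral θ z ∈ Q := by
  -- The correction by q of the boundary makes Φ take values in Q on every generator, and it
  -- vanishes on cycles.
  let Φ : 𝒢.Chain1 →ₗ[ℤ] ℝ :=
    𝒢.chainIntegral θ + Finsupp.linearCombination ℤ q ∘ₗ 𝒢.boundary1
  let π : ℝ →ₗ[ℤ] ℝ ⧸ Q := (QuotientAddGroup.mk' Q).toIntLinearMap
  have hΦ : π ∘ₗ Φ = 0 := by
    refine chain1_hom_ext (fun g => ?_) (fun γ => ?_)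
    · refine (QuotientAddGroup.eq_zero_iff _).2 ?_
      have : Φ (𝒢.arrowChain g) = -(q (𝒢.tgt g) - q (𝒢.src g)) := by
        simp [Φ, boundary1_arrowChain]
      rw [this]
      exact Q.neg_mem (h.2 g)
    · refine (QuotientAddGroup.eq_zero_iff _).2 ?_
      have : Φ (𝒢.pathChain γ) = θ.pathIntegral γ + (q (γ 0) - q (γ 1)) := by
        simp [Φ, boundary1_pathChain]
      rw [this]
      exact h.pathIntegral_mem hθ γ
  have h1 := (QuotientAddGroup.eq_zero_iff _).1 (LinearMap.congr_fun hΦ z)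
  have h2 : Φ z = 𝒢.chainIntegral θ z := by
    have hz : 𝒢.boundary1 z = 0 := hz
    simp [Φ, hz]
  rwa [h2] at h1

theorem chainIntegral_add (θ η : 𝒢.closedBasicForms) :
    𝒢.chainIntegral ((θ + η : 𝒢.closedBasicForms) : OneForm E M) =
      𝒢.chainIntegral (θ : OneForm E M) + 𝒢.chainIntegral (η : OneForm E M) := by
  refine chain1_hom_ext (fun g => by simp) (fun γ => ?_)
  simpa using OneForm.pathIntegral_add θ.2.1 η.2.1 (θ + η).2.1 γ

theorem chainIntegral_chain (hθ : θ.IsClosedForm) {x y : M} (σ : 𝒢.GPath x y) :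
    𝒢.chainIntegral θ σ.chain = σ.integral θ := by
  simp only [GPath.chain, map_add, map_sum, chainIntegral_arrowChain, chainIntegral_pathChain,
    Finset.sum_const_zero, zero_add, GPath.integral]
  exact Finset.sum_congr rfl fun k _ =>
    OneForm.pathIntegral_eq_intervalIntegral hθ (σ.smooth_path k) fun _ => rfl

/-- On cycles, the integral only depends on the basic cohomology class. -/
theorem chainIntegral_eq_of_basicClass_eq {θ η : 𝒢.closedBasicForms}
    (h : 𝒢.basicClass θ = 𝒢.basicClass η) {z : 𝒢.Chain1} (hz : z ∈ 𝒢.Cycle1) :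
    𝒢.chainIntegral (θ : OneForm E M) z = 𝒢.chainIntegral (η : OneForm E M) z := by
  obtain ⟨q, hq⟩ := exists_isPrimitiveModulo_bot ((Submodule.Quotient.eq _).1 h)
  have h1 := AddSubgroup.mem_bot.1 (hq.chainIntegral_mem (θ - η).2.1 z hz)
  have h2 := chainIntegral_add (θ - η) η
  rw [sub_add_cancel] at h2
  rw [h2, LinearMap.add_apply, h1, zero_add]

theorem isPeriodHom_periodHom [IsManifold 𝓘(ℝ, F) ∞ G] (θ : 𝒢.closedBasicForms) :
    𝒢.IsPeriodHom (𝒢.basicClass θ) (periodHom θ).toAddMonoidHom := by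
  intro η h x σ
  have hz : σ.chain ∈ 𝒢.Cycle1 := by
    rw [LinearMap.mem_ker, GPath.boundary1_chain, sub_self]
  rw [← chainIntegral_chain η.2.1, chainIntegral_eq_of_basicClass_eq h hz]
  rfl

/-- On a `G`-connected groupoid, a closed basic form without periods is exact. -/
theorem IsGConnected.mem_exactBasicForms (hconn : 𝒢.IsGConnected) {θ : 𝒢.closedBasicForms}
    (h : ∀ z ∈ 𝒢.Cycle1, 𝒢.chainIntegral (θ : OneForm E M) z = 0) : θ ∈ 𝒢.exactBasicForms := by
  rcases isEmpty_or_nonempty M with hM | ⟨⟨x₀⟩⟩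
  · exact ⟨fun _ => 0, ⟨contMDiff_const, fun _ => rfl⟩, fun x => (hM.false x).elim⟩
  let σ : ∀ x, 𝒢.GPath x₀ x := fun x => (hconn x₀ x).some
  let q : M → ℝ := fun x => 𝒢.chainIntegral (θ : OneForm E M) (σ x).chain
  have key : ∀ (c : 𝒢.Chain1) (x y : M),
      𝒢.boundary1 c = Finsupp.single x (1 : ℤ) - Finsupp.single y 1 →
      𝒢.chainIntegral (θ : OneForm E M) c = q y - q x := by
    intro c x y hc
    -- The chosen paths from the base point close c up to a cycle, whose integral is zero by
    -- hypothesis.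
    have := h ((σ x).chain + c - (σ y).chain) (by
      rw [LinearMap.mem_ker, map_sub, map_add, GPath.boundary1_chain, GPath.boundary1_chain, hc]
      abel)
    rw [map_sub, map_add] at this
    linarith
  refine IsPrimitiveModulo.mem_exactBasicForms (q := q) ⟨fun x => ?_, fun g => ?_⟩
  · obtain ⟨V, hV, hx, hVc, hp⟩ := OneForm.exists_nhds_primitive (E := E) x
    obtain ⟨f, hf⟩ := hp θ θ.2.1
    refine ⟨fun y => f y + (q x - f x), (hf x hx).add_const _, ?_⟩
    filter_upwards [hV.mem_nhds hx] with y hy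
    obtain ⟨γ, hγ⟩ := hVc.joinedIn x hx y hy
    have h1 := key (𝒢.pathChain (γ : C(unitInterval, M))) x y
      (by rw [boundary1_pathChain]; simp)
    have h2 := OneForm.pathIntegral_eq_of_isPrimitiveAt θ.2.1 (γ := (γ : C(unitInterval, M)))
      (fun r => hf _ (hγ r))
    have h3 : (γ : C(unitInterval, M)) 0 = x := γ.source
    have h4 : (γ : C(unitInterval, M)) 1 = y := γ.target
    rw [chainIntegral_pathChain, h2, h3, h4] at h1
    rw [AddSubgroup.mem_bot]
    linarith
  · have := key (𝒢.arrowChain g) _ _ (boundary1_arrowChain g)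
    rw [chainIntegral_arrowChain] at this
    exact AddSubgroup.mem_bot.2 this.symm

end

end LieGroupoid

/-! ### Étale groupoids: local sections of the source map -/

namespace LieGroupoid

variable {E F M G : Type*}
    [NormedAddCommGroup E] [NormedSpace ℝ E] [NormedAddCommGroup F] [NormedSpace ℝ F]
    [TopologicalSpace M] [ChartedSpace E M]
    [TopologicalSpace G] [ChartedSpace F G]
    {𝒢 : LieGroupoid E F M G}

theorem inv_inv (𝒢 : LieGroupoid E F M G) (g : G) : 𝒢.inv (𝒢.inv g) = g := by
  have h1 := 𝒢.mul_assoc (𝒢.inv (𝒢.inv g)) (𝒢.inv g) g (by rw [𝒢.src_inv]) (𝒢.src_inv g)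
  rw [𝒢.inv_mul, 𝒢.src_inv, 𝒢.one_mul, 𝒢.inv_mul] at h1
  have h2 := 𝒢.mul_one (𝒢.inv (𝒢.inv g))
  rw [𝒢.src_inv, 𝒢.tgt_inv] at h2
  rw [← h2, ← h1]

/-- A smooth section `σ` over the open set `N` of a map `f`, whose image is the open set `O`. -/
structure IsLocalSection (f : G → M) (O : Set G) (N : Set M) (σ : M → G) : Prop where
  isOpen_image : IsOpen O
  isOpen_base : IsOpen N
  contMDiffOn : ContMDiffOn 𝓘(ℝ, E) 𝓘(ℝ, F) ∞ σ N
  mapsTo : MapsTo f O N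
  mapsTo_section : MapsTo σ N O
  right_inv : ∀ y ∈ N, f (σ y) = y
  left_inv : ∀ h ∈ O, σ (f h) = h

theorem exists_isLocalSection_of_isLocalDiffeomorphAt {f : G → M} {g : G}
    (hf : IsLocalDiffeomorphAt 𝓘(ℝ, F) 𝓘(ℝ, E) ∞ f g) {U : Set G} (hU : U ∈ 𝓝 g) :
    ∃ O N σ, IsLocalSection (E := E) (F := F) f O N σ ∧ g ∈ O ∧ O ⊆ U := by
  obtain ⟨Φ, hg, hΦ⟩ := hf
  obtain ⟨U', hU', hU'o, hgU⟩ := mem_nhds_iff.1 hU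
  refine ⟨Φ.source ∩ U', Φ.target ∩ Φ.symm ⁻¹' U', Φ.symm, ?_, ⟨hg, hgU⟩,
    inter_subset_right.trans hU'⟩
  have hs : ContMDiffOn 𝓘(ℝ, E) 𝓘(ℝ, F) ∞ Φ.symm Φ.target := Φ.symm.contMDiffOn
  have left : ∀ h ∈ Φ.source, Φ.symm (f h) = h := fun h hh => by
    rw [hΦ hh]; exact Φ.toPartialEquiv.left_inv hh
  refine ⟨Φ.open_source.inter hU'o, hs.continuousOn.isOpen_inter_preimage Φ.open_target hU'o,
    hs.mono inter_subset_left, ?_, ?_, ?_, fun h hh => left h hh.1⟩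
  · rintro h ⟨hh, hh'⟩
    refine ⟨?_, ?_⟩
    · rw [hΦ hh]; exact Φ.toPartialEquiv.map_source hh
    · rw [mem_preimage, left h hh]; exact hh'
  · rintro y ⟨hy, hy'⟩
    exact ⟨Φ.toPartialEquiv.map_target hy, hy'⟩
  · rintro y ⟨hy, -⟩
    exact (hΦ (Φ.toPartialEquiv.map_target hy)).trans (Φ.toPartialEquiv.right_inv hy)

/-- If it is the target map that is a local diffeomorphism, its sections become sections of the
source map by inversion. -/
theorem IsEtale.exists_isLocalSection (he : 𝒢.IsEtale) (g : G) {U : Set G} (hU : U ∈ 𝓝 g) :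
    ∃ O N σ, IsLocalSection (E := E) (F := F) 𝒢.src O N σ ∧ g ∈ O ∧ O ⊆ U := by
  rcases he with he | he
  · exact exists_isLocalSection_of_isLocalDiffeomorphAt (he g) hU
  · have hi := 𝒢.contMDiff_inv.continuous
    obtain ⟨O, N, σ, h, hg, hO⟩ := exists_isLocalSection_of_isLocalDiffeomorphAt (he (𝒢.inv g))
      (U := 𝒢.inv ⁻¹' U) (hi.continuousAt (by rwa [𝒢.inv_inv]))
    refine ⟨𝒢.inv ⁻¹' O, N, 𝒢.inv ∘ σ, ⟨h.isOpen_image.preimage hi, h.isOpen_base,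
      𝒢.contMDiff_inv.comp_contMDiffOn h.contMDiffOn, ?_, ?_, ?_, ?_⟩, hg, ?_⟩
    · intro k hk
      rw [← 𝒢.tgt_inv]; exact h.mapsTo hk
    · intro y hy
      rw [mem_preimage, Function.comp, 𝒢.inv_inv]; exact h.mapsTo_section hy
    · intro y hy
      rw [Function.comp, 𝒢.src_inv]; exact h.right_inv y hy
    · intro k hk
      rw [Function.comp, ← 𝒢.tgt_inv, h.left_inv _ hk, 𝒢.inv_inv]
    · intro k hk
      have := hO hk
      rwa [mem_preimage, 𝒢.inv_inv] at this

theorem IsLocalSection.contMDiffAt {f : G → M} {O N σ}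
    (h : IsLocalSection (E := E) (F := F) f O N σ) {y : M} (hy : y ∈ N) :
    ContMDiffAt 𝓘(ℝ, E) 𝓘(ℝ, F) ∞ σ y :=
  h.contMDiffOn.contMDiffAt (h.isOpen_base.mem_nhds hy)

theorem IsEtale.isOpenMap_src (he : 𝒢.IsEtale) : IsOpenMap 𝒢.src := by
  intro U hU
  rw [isOpen_iff_mem_nhds]
  rintro _ ⟨g, hg, rfl⟩
  obtain ⟨O, N, σ, h, hgO, hO⟩ := he.exists_isLocalSection g (hU.mem_nhds hg)
  filter_upwards [h.isOpen_base.mem_nhds (h.mapsTo hgO)] with y hy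
  exact ⟨σ y, hO (h.mapsTo_section hy), h.right_inv y hy⟩

/-- If the orbit space is compact, finitely many members of a family of neighbourhoods meet all
orbits. -/
theorem IsEtale.exists_finset_forall_orbit (he : 𝒢.IsEtale) (hc : CompactSpace 𝒢.OrbitSpace)
    {B : M → Set M} (hB : ∀ p, B p ∈ 𝓝 p) :
    ∃ s : Finset M, ∀ y, ∃ p ∈ s, ∃ h, 𝒢.src h = y ∧ 𝒢.tgt h ∈ B p := by
  let U : M → Set 𝒢.OrbitSpace := fun p => Quotient.mk 𝒢.orbitSetoid '' interior (B p)
  -- The saturation of an open set is open because the source map is open.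
  have hpre : ∀ p, Quotient.mk 𝒢.orbitSetoid ⁻¹' U p = 𝒢.src '' (𝒢.tgt ⁻¹' interior (B p)) := by
    intro p
    ext y
    constructor
    · rintro ⟨z, hz, hzy⟩
      obtain ⟨g, hg, hg'⟩ := 𝒢.orbitSetoid.iseqv.symm (Quotient.exact hzy)
      exact ⟨g, by rwa [mem_preimage, hg'], hg⟩
    · rintro ⟨g, hg, rfl⟩
      exact ⟨𝒢.tgt g, hg, (Quotient.sound (show 𝒢.orbitSetoid _ _ from ⟨g, rfl, rfl⟩)).symm⟩
  have hU : ∀ p, IsOpen (U p) := by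
    intro p
    rw [← isQuotientMap_quotient_mk'.isOpen_preimage]
    exact hpre p ▸ he.isOpenMap_src _ (isOpen_interior.preimage 𝒢.contMDiff_tgt.continuous)
  obtain ⟨s, hs⟩ := isCompact_univ.elim_finite_subcover U hU (by
    intro z _
    obtain ⟨y, rfl⟩ := Quotient.exists_rep z
    exact mem_iUnion.2 ⟨y, y, mem_interior_iff_mem_nhds.2 (hB y), rfl⟩)
  refine ⟨s, fun y => ?_⟩
  obtain ⟨p, hp, hy⟩ := mem_iUnion₂.1 (hs (mem_univ (Quotient.mk 𝒢.orbitSetoid y)))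
  have hy' : y ∈ Quotient.mk 𝒢.orbitSetoid ⁻¹' U p := hy
  rw [hpre] at hy'
  obtain ⟨h, hh, hhy⟩ := hy'
  exact ⟨p, hp, h, hhy, interior_subset hh⟩

theorem IsProper.isCompact_setOf (hp : 𝒢.IsProper) {A B : Set M} (hA : IsCompact A)
    (hB : IsCompact B) : IsCompact {g | 𝒢.src g ∈ A ∧ 𝒢.tgt g ∈ B} :=
  IsProperMap.isCompact_preimage hp (hA.prod hB)

/-! ### Finitely many jump functionals and finite-dimensionality. -/

section

variable [IsManifold 𝓘(ℝ, E) ∞ M]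

/-- A primitive of a basic form is transported along a local section of the source map. -/
theorem IsLocalSection.isPrimitiveAt {θ : OneForm E M} {O N σ}
    (hσ : IsLocalSection (E := E) (F := F) 𝒢.src O N σ) (hb : 𝒢.IsBasicForm θ) {f : M → ℝ} {x : M}
    (hx : x ∈ N) (hf : θ.IsPrimitiveAt f (𝒢.tgt (σ x))) :
    θ.IsPrimitiveAt (fun y => f (𝒢.tgt (σ y))) x := by
  have hc : ContinuousAt (fun y => 𝒢.tgt (σ y)) x :=
    𝒢.contMDiff_tgt.continuous.continuousAt.comp (hσ.contMDiffAt hx).continuousAt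
  filter_upwards [hc.eventually hf, hσ.isOpen_base.mem_nhds hx] with y hy hyN
  have hσy := hσ.contMDiffAt hyN
  have dσ : MDifferentiableAt 𝓘(ℝ, E) 𝓘(ℝ, F) σ y := hσy.mdifferentiableAt (by decide)
  have dt : MDifferentiableAt 𝓘(ℝ, F) 𝓘(ℝ, E) 𝒢.tgt (σ y) :=
    𝒢.contMDiff_tgt.mdifferentiableAt (by decide)
  have ds : MDifferentiableAt 𝓘(ℝ, F) 𝓘(ℝ, E) 𝒢.src (σ y) :=
    𝒢.contMDiff_src.mdifferentiableAt (by decide)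
  have df := hy.1.mdifferentiableAt (by decide)
  refine ⟨hy.1.comp y (𝒢.contMDiff_tgt.contMDiffAt.comp y hσy), fun v => ?_⟩
  have e1 := mfderiv_comp (I'' := 𝓘(ℝ, ℝ)) y df (dt.comp y dσ)
  have e2 := mfderiv_comp (I'' := 𝓘(ℝ, E)) y dt dσ
  have e3 := mfderiv_comp (I'' := 𝓘(ℝ, E)) y ds dσ
  have e4 : (𝒢.src ∘ σ) =ᶠ[𝓝 y] id := by
    filter_upwards [hσ.isOpen_base.mem_nhds hyN] with z hz using hσ.right_inv z hz
  rw [e4.mfderiv_eq, mfderiv_id] at e3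
  refine Eq.trans ?_ (congrArg (fun L : E →L[ℝ] ℝ => L v) e1).symm
  refine Eq.trans ?_ (hy.2 _)
  refine Eq.trans ?_ (congrArg (fun L : E →L[ℝ] E => θ.evalAt (𝒢.tgt (σ y)) (L v)) e2).symm
  refine Eq.trans ?_ (hb (σ y) _)
  refine Eq.trans ?_ (congrArg (fun L : E →L[ℝ] E => θ.evalAt (𝒢.src (σ y)) (L v)) e3)
  exact (θ.evalAt_congr (hσ.right_inv y hyN) v).symm

variable [FiniteDimensional ℝ E]

/-- Integration along a path, as a functional on closed basic forms. -/
def pathIntegralLinear (𝒢 : LieGroupoid E F M G) (γ : C(unitInterval, M)) :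
    𝒢.closedBasicForms →ₗ[ℝ] ℝ where
  toFun θ := (θ : OneForm E M).pathIntegral γ
  map_add' θ η := OneForm.pathIntegral_add θ.2.1 η.2.1 (θ + η).2.1 γ
  map_smul' c θ := OneForm.pathIntegral_smul θ.2.1 c (c • θ).2.1 γ

/-- Near every point the closed basic forms have primitives that depend linearly on the form. -/
theorem exists_linear_primitive (𝒢 : LieGroupoid E F M G) (p : M) :
    ∃ V : Set M, IsOpen V ∧ p ∈ V ∧ ∃ ℓ : M → 𝒢.closedBasicForms →ₗ[ℝ] ℝ,
      ∀ θ : 𝒢.closedBasicForms, ∀ y ∈ V, (θ : OneForm E M).IsPrimitiveAt (fun z => ℓ z θ) y := by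
  obtain ⟨V, hV, hp, hc, hf⟩ := OneForm.exists_nhds_primitive (E := E) p
  have hγ : ∀ y, ∃ γ : C(unitInterval, M), y ∈ V → γ 0 = p ∧ γ 1 = y ∧ ∀ r, γ r ∈ V := by
    intro y
    by_cases hy : y ∈ V
    · obtain ⟨γ, hγ⟩ := hc.joinedIn p hp y hy
      exact ⟨γ, fun _ => ⟨γ.source, γ.target, hγ⟩⟩
    · exact ⟨ContinuousMap.const _ p, fun h => (hy h).elim⟩
  choose γ hγ using hγ
  refine ⟨V, hV, hp, fun y => 𝒢.pathIntegralLinear (γ y), fun θ y hy => ?_⟩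
  obtain ⟨f, hfθ⟩ := hf θ θ.2.1
  refine ((hfθ y hy).add_const (-f p)).congr ?_
  filter_upwards [hV.mem_nhds hy] with z hz
  obtain ⟨h0, h1, hr⟩ := hγ z hz
  have := OneForm.pathIntegral_eq_of_isPrimitiveAt θ.2.1 (fun r => hfθ _ (hr r))
  rw [h0, h1] at this
  exact this

variable [IsManifold 𝓘(ℝ, F) ∞ G]

/-- Modulo the values of finitely many linear functionals, every closed basic form has an invariant
primitive. -/
theorem exists_finite_functionals (he : 𝒢.IsEtale) (hp : 𝒢.IsProper)
    (hc : CompactSpace 𝒢.OrbitSpace) :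
    ∃ 𝓛 : Set (𝒢.closedBasicForms →ₗ[ℝ] ℝ), 𝓛.Finite ∧ ∀ θ : 𝒢.closedBasicForms, ∃ q,
      𝒢.IsPrimitiveModulo (θ : OneForm E M) (AddSubgroup.closure ((fun L => L θ) '' 𝓛)) q := by
  have : LocallyCompactSpace M := ChartedSpace.locallyCompactSpace E M
  have : LocallyConnectedSpace G := ChartedSpace.locallyConnectedSpace F G
  choose V hVo hpV ℓ hℓ using 𝒢.exists_linear_primitive
  choose B hBc hpB hBV using fun p => exists_compact_subset (hVo p) (hpV p)
  obtain ⟨s, hs⟩ := he.exists_finset_forall_orbit hc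
    (fun p => isOpen_interior.mem_nhds (hpB p))
  let L : M → M → G → 𝒢.closedBasicForms →ₗ[ℝ] ℝ := fun p p' g => ℓ p' (𝒢.tgt g) - ℓ p (𝒢.src g)
  let K : M → M → Set G := fun p p' => {g | 𝒢.src g ∈ B p ∧ 𝒢.tgt g ∈ B p'}
  have hLc : ∀ p p', ∀ g ∈ K p p', ∀ᶠ h in 𝓝 g, L p p' h = L p p' g := by
    intro p p' g hg
    have hn : 𝒢.src ⁻¹' V p ∩ 𝒢.tgt ⁻¹' V p' ∈ 𝓝 g :=
      (((hVo p).preimage 𝒢.contMDiff_src.continuous).inter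
        ((hVo p').preimage 𝒢.contMDiff_tgt.continuous)).mem_nhds ⟨hBV p hg.1, hBV p' hg.2⟩
    -- Local constancy is needed for all θ on the same neighbourhood; a connected W that does not
    -- depend on θ provides it.
    obtain ⟨W, hW, hWo, hgW, hWc⟩ := locallyConnectedSpace_iff_subsets_isOpen_isConnected.1
      this g _ hn
    filter_upwards [hWo.mem_nhds hgW] with h hh
    ext θ
    refine hWc.isPreconnected.eq_of_eventually_eq (w := fun k => L p p' k θ) (fun k hk => ?_) hh hgW
    exact mem_nhdsWithin_of_mem_nhds
      (θ.2.2.eventually_sub_eq (hℓ p' θ _ (hW hk).2) (hℓ p θ _ (hW hk).1))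
  have hLf : ∀ p p', (L p p' '' K p p').Finite := by
    intro p p'
    obtain ⟨t, -, ht⟩ := (hp.isCompact_setOf (hBc p) (hBc p')).elim_nhds_subcover
      (fun g => {h | L p p' h = L p p' g}) (hLc p p')
    refine (t.finite_toSet.image (L p p')).subset ?_
    rintro _ ⟨g, hg, rfl⟩
    obtain ⟨h, hh, hgh⟩ := mem_iUnion₂.1 (ht hg)
    exact ⟨h, hh, hgh.symm⟩
  refine ⟨⋃ p ∈ s, ⋃ p' ∈ s, L p p' '' K p p',
    s.finite_toSet.biUnion fun p _ => s.finite_toSet.biUnion fun p' _ => hLf p p', fun θ => ?_⟩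
  set Q := AddSubgroup.closure
    ((fun L => L θ) '' ⋃ p ∈ s, ⋃ p' ∈ s, L p p' '' K p p') with hQ
  have hmem : ∀ p ∈ s, ∀ p' ∈ s, ∀ z ∈ B p, ∀ z' ∈ B p', 𝒢.orbitSetoid z z' →
      ℓ p' z' θ - ℓ p z θ ∈ Q := by
    rintro p hp p' hp' z hz z' hz' ⟨g, rfl, rfl⟩
    refine AddSubgroup.subset_closure ⟨L p p' g, ?_, rfl⟩
    exact mem_iUnion₂.2 ⟨p, hp, mem_iUnion₂.2 ⟨p', hp', g, ⟨hz, hz'⟩, rfl⟩⟩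
  choose p hps h hsrc htgt using hs
  have horb : ∀ y, 𝒢.orbitSetoid y (𝒢.tgt (h y)) := fun y => ⟨h y, hsrc y, rfl⟩
  -- Each y is moved by a chosen arrow into some `B (p y)` and the primitive is read there. The
  -- choices need no continuity, since changing them changes the value by a jump in Q.
  refine ⟨fun y => ℓ (p y) (𝒢.tgt (h y)) θ, fun x => ?_, fun g => ?_⟩
  · obtain ⟨O, N, σ, hσ, hO, -⟩ := he.exists_isLocalSection (h x) univ_mem
    have hxN : x ∈ N := hsrc x ▸ hσ.mapsTo hO
    have hσx : σ x = h x := by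
      have := hσ.left_inv _ hO
      rwa [hsrc] at this
    -- Near x the comparison primitive keeps `p x` fixed and uses the section σ through `h x`. It
    -- differs from q(y) by the jump across an arrow from `tgt (h y)` to `tgt (σ y)`.
    refine ⟨fun y => ℓ (p x) (𝒢.tgt (σ y)) θ,
      hσ.isPrimitiveAt (f := fun z => ℓ (p x) z θ) θ.2.2 hxN
        (hℓ _ θ _ (by rw [hσx]; exact hBV _ (interior_subset (htgt x)))), ?_⟩
    have hc : ContinuousAt (fun y => 𝒢.tgt (σ y)) x :=
      𝒢.contMDiff_tgt.continuous.continuousAt.comp (hσ.contMDiffAt hxN).continuousAt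
    have hx : 𝒢.tgt (σ x) ∈ interior (B (p x)) := by rw [hσx]; exact htgt x
    filter_upwards [hc (isOpen_interior.mem_nhds hx),
      hσ.isOpen_base.mem_nhds hxN] with y hy hyN
    refine hmem _ (hps y) _ (hps x) _ (interior_subset (htgt y)) _ (interior_subset hy) ?_
    exact 𝒢.orbitSetoid.trans (𝒢.orbitSetoid.symm (horb y)) ⟨σ y, hσ.right_inv y hyN, rfl⟩
  · refine hmem _ (hps _) _ (hps _) _ (interior_subset (htgt _)) _ (interior_subset (htgt _)) ?_
    exact 𝒢.orbitSetoid.trans (𝒢.orbitSetoid.symm (horb _))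
      (𝒢.orbitSetoid.trans ⟨g, rfl, rfl⟩ (horb _))

theorem finiteDimensional_basicH1 (he : 𝒢.IsEtale) (hp : 𝒢.IsProper)
    (hc : CompactSpace 𝒢.OrbitSpace) : FiniteDimensional ℝ 𝒢.BasicH1 := by
  obtain ⟨𝓛, hfin, h𝓛⟩ := exists_finite_functionals he hp hc
  have := hfin.to_subtype
  let T : 𝒢.closedBasicForms →ₗ[ℝ] 𝓛 → ℝ := LinearMap.pi fun L => L
  have hT : LinearMap.ker T ≤ 𝒢.exactBasicForms := by
    intro θ hθ
    obtain ⟨q, hq⟩ := h𝓛 θ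
    have h0 : AddSubgroup.closure ((fun L => L θ) '' 𝓛) = ⊥ := by
      rw [AddSubgroup.closure_eq_bot_iff]
      rintro _ ⟨L, hL, rfl⟩
      exact congrFun (LinearMap.mem_ker.1 hθ) ⟨L, hL⟩
    rw [h0] at hq
    exact hq.mem_exactBasicForms
  have : Module.Finite ℝ (𝒢.closedBasicForms ⧸ LinearMap.ker T) :=
    Module.Finite.equiv T.quotKerEquivRange.symm
  exact Module.Finite.of_surjective (Submodule.factor hT) (Submodule.factor_surjective hT)

end

end LieGroupoid

/-! ### Gluing local functions to a closed form -/

namespace OneForm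

variable {E M : Type*} [NormedAddCommGroup E] [NormedSpace ℝ E]
    [TopologicalSpace M] [ChartedSpace E M] [IsManifold 𝓘(ℝ, E) ∞ M]

theorem contMDiffAt_mfderiv_section {f : M → ℝ} {x : M}
    (hf : ContMDiffAt 𝓘(ℝ, E) 𝓘(ℝ, ℝ) ∞ f x) :
    ContMDiffAt 𝓘(ℝ, E) (𝓘(ℝ, E).prod 𝓘(ℝ, E →L[ℝ] ℝ)) ∞
      (fun y => Bundle.TotalSpace.mk' (E →L[ℝ] ℝ)
        (E := fun x : M => TangentSpace 𝓘(ℝ, E) x →L[ℝ] Bundle.Trivial M ℝ x)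
        y (mfderiv 𝓘(ℝ, E) 𝓘(ℝ, ℝ) f y)) x := by
  rw [contMDiffAt_hom_bundle]
  refine ⟨contMDiffAt_id, ?_⟩
  have := hf.mfderiv_const (m := ∞) (by decide)
  refine this.congr_of_eventuallyEq (Eventually.of_forall fun y => ?_)
  simp [inTangentCoordinates, ContinuousLinearMap.inCoordinates]
  exact (ContinuousLinearMap.id_comp _).symm

/-- Functions `w x`, smooth near `x` and differing by locally constant functions, are the local
primitives of a form. -/
theorem exists_isPrimitiveAt_of_local (w : M → M → ℝ)
    (hw : ∀ x, ∀ᶠ y in 𝓝 x, ContMDiffAt 𝓘(ℝ, E) 𝓘(ℝ, ℝ) ∞ (w x) y ∧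
      ∀ᶠ z in 𝓝 y, w y z - w y y = w x z - w x y) :
    ∃ θ : OneForm E M, ∀ x, θ.IsPrimitiveAt (w x) x := by
  have key : ∀ x, ∀ᶠ y in 𝓝 x, mfderiv 𝓘(ℝ, E) 𝓘(ℝ, ℝ) (w x) y =
      (mfderiv 𝓘(ℝ, E) 𝓘(ℝ, ℝ) (w y) y : E →L[ℝ] ℝ) := by
    intro x
    filter_upwards [hw x, eventually_eventually_nhds.2 (hw x)] with y hy hy'
    have h : w y =ᶠ[𝓝 y] w x + fun _ => w y y - w x y := by
      filter_upwards [hy.2] with z hz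
      simp only [Pi.add_apply]
      linarith
    rw [h.mfderiv_eq, mfderiv_add (hy.1.mdifferentiableAt (by decide)) mdifferentiableAt_const,
      mfderiv_const]
    exact (add_zero _).symm
  refine ⟨⟨fun y => mfderiv 𝓘(ℝ, E) 𝓘(ℝ, ℝ) (w y) y, fun x => ?_⟩, fun x => ?_⟩
  · refine (contMDiffAt_mfderiv_section (hw x).self_of_nhds.1).congr_of_eventuallyEq ?_
    filter_upwards [key x] with y hy
    exact congrArg _ hy.symm
  · filter_upwards [hw x, key x] with y hy hy'
    exact ⟨hy.1, fun v => (congrArg (fun L : E →L[ℝ] ℝ => L v) hy').symm⟩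

/-- In a chart this is the symmetry of second derivatives of the local primitives. -/
theorem isClosedForm_of_isPrimitiveAt {θ : OneForm E M} (h : ∀ x, ∃ f, θ.IsPrimitiveAt f x) :
    θ.IsClosedForm := by
  intro x₀ y hy u v
  obtain ⟨f, hf⟩ := h ((chartAt E x₀).symm y)
  have ho := (chartAt E x₀).open_target
  have hs : ContMDiffAt 𝓘(ℝ, E) 𝓘(ℝ, E) ∞ (chartAt E x₀).symm y :=
    contMDiffOn_chart_symm.contMDiffAt (ho.mem_nhds hy)
  have hd : ∀ w : E, (fun z => θ.inChart x₀ z w) =ᶠ[𝓝 y]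
      fun z => fderiv ℝ (f ∘ (chartAt E x₀).symm) z w := by
    intro w
    filter_upwards [hs.continuousAt.eventually hf, ho.mem_nhds hy] with z hz hzt
    rw [fderiv_comp_chartAt_symm x₀ hzt (hz.1.mdifferentiableAt (by decide))]
    exact hz.2 _
  have hc : ContDiffAt ℝ ∞ (f ∘ (chartAt E x₀).symm) y :=
    (hf.contMDiffAt.comp y hs).contDiffAt
  have hdd : DifferentiableAt ℝ (fderiv ℝ (f ∘ (chartAt E x₀).symm)) y :=
    (hc.fderiv_right (m := 1) (by decide)).differentiableAt (by decide)
  have hsymm := (hc.isSymmSndFDerivAt (by rw [minSmoothness_of_isRCLikeNormedField]; decide)) u v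
  have e : ∀ w, fderiv ℝ (fun z => fderiv ℝ (f ∘ (chartAt E x₀).symm) z w) y =
      (fderiv ℝ (fderiv ℝ (f ∘ (chartAt E x₀).symm)) y).flip w := by
    intro w
    refine (hdd.hasFDerivAt.clm_apply (hasFDerivAt_const w y)).fderiv.trans ?_
    ext z; simp
  rw [(hd v).fderiv_eq, (hd u).fderiv_eq, e, e]
  exact sub_eq_zero.2 hsymm

end OneForm

/-! ### Averaging over the fibres of the source map -/

namespace LieGroupoid

variable {E F M G : Type*}
    [NormedAddCommGroup E] [NormedSpace ℝ E] [NormedAddCommGroup F] [NormedSpace ℝ F]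
    [TopologicalSpace M] [ChartedSpace E M]
    [TopologicalSpace G] [ChartedSpace F G]
    {𝒢 : LieGroupoid E F M G}

/-- The sum of `a` over the arrows with source `y`. -/
def fiberSum (𝒢 : LieGroupoid E F M G) (a : G → ℝ) (y : M) : ℝ := ∑ᶠ h ∈ 𝒢.src ⁻¹' {y}, a h

/-- Near `x`, the arrows with target in a compact set are the values of finitely many disjoint
local sections of the source map. -/
theorem IsEtale.exists_sections [T2Space M] [T2Space G] (he : 𝒢.IsEtale) (hp : 𝒢.IsProper)
    {K : Set M} (hK : IsCompact K) (x : M) :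
    ∃ (t : Finset G) (σ : G → M → G),
      (∀ g ∈ t, 𝒢.src g = x ∧ σ g x = g ∧ ContMDiffAt 𝓘(ℝ, E) 𝓘(ℝ, F) ∞ (σ g) x) ∧
      ∀ᶠ y in 𝓝 x, (∀ g ∈ t, 𝒢.src (σ g y) = y) ∧ InjOn (fun g => σ g y) t ∧
        ∀ h, 𝒢.src h = y → 𝒢.tgt h ∈ K → ∃ g ∈ t, σ g y = h := by
  set C : Set G := {g | 𝒢.src g ∈ ({x} : Set M) ∧ 𝒢.tgt g ∈ K}
  have hC : IsCompact C := hp.isCompact_setOf isCompact_singleton hK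
  -- A local section takes only one value at x, so each member of a finite cover of the compact set
  -- C contains a single arrow of C.
  have hCf : C.Finite := by
    choose O N σ hσ hO _ using fun g => he.exists_isLocalSection g univ_mem
    obtain ⟨t, htC, ht⟩ := hC.elim_nhds_subcover O
      fun g _ => (hσ g).isOpen_image.mem_nhds (hO g)
    refine t.finite_toSet.subset fun h hh => ?_
    obtain ⟨g, hg, hgh⟩ := mem_iUnion₂.1 (ht hh)
    have h1 := (hσ g).left_inv h hgh
    have h2 := (hσ g).left_inv g (hO g)
    have h3 : 𝒢.src h = x := hh.1
    have h4 : 𝒢.src g = x := (htC g hg).1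
    rw [h3] at h1
    rw [h4] at h2
    rw [← h1, h2]
    exact hg
  obtain ⟨U, hU, hUd⟩ := hCf.t2_separation
  choose O N σ hσ hO hOU using
    fun g => he.exists_isLocalSection g ((hU g).2.mem_nhds (hU g).1)
  have hsx : ∀ g ∈ C, 𝒢.src g = x := fun g hg => hg.1
  have hxN : ∀ g ∈ C, x ∈ N g := fun g hg => hsx g hg ▸ (hσ g).mapsTo (hO g)
  refine ⟨hCf.toFinset, σ, fun g hg => ?_, ?_⟩
  · rw [hCf.mem_toFinset] at hg
    refine ⟨hsx g hg, ?_, (hσ g).contMDiffAt (hxN g hg)⟩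
    have := (hσ g).left_inv g (hO g)
    rwa [hsx g hg] at this
  have h1 : ∀ᶠ y in 𝓝 x, ∀ g ∈ C, y ∈ N g :=
    (eventually_all_finite hCf).2 fun g hg => (hσ g).isOpen_base.mem_nhds (hxN g hg)
  -- D holds the arrows into K missed by the sections. Its image in M × M is closed by properness
  -- and avoids {x} × K, so compactness of K yields a neighbourhood of x over which no arrow is
  -- missed.
  set D : Set G := 𝒢.tgt ⁻¹' K \ ⋃ g ∈ C, O g
  have hD : IsClosed D := (hK.isClosed.preimage 𝒢.contMDiff_tgt.continuous).sdiff
    (isOpen_biUnion fun g _ => (hσ g).isOpen_image)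
  have hΨ : IsClosed ((fun g => (𝒢.src g, 𝒢.tgt g)) '' D) := IsProperMap.isClosedMap hp _ hD
  have h2 : ∀ᶠ y in 𝓝 x, ∀ k ∈ K, (y, k) ∉ (fun g => (𝒢.src g, 𝒢.tgt g)) '' D := by
    refine hK.eventually_forall_of_forall_eventually fun k hk => ?_
    refine hΨ.isOpen_compl.mem_nhds ?_
    rintro ⟨h, hh, hhk⟩
    obtain ⟨e1, e2⟩ := Prod.mk.inj hhk
    exact hh.2 (mem_biUnion (x := h) ⟨e1, hh.1⟩ (hO h))
  filter_upwards [h1, h2] with y hy1 hy2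
  refine ⟨fun g hg => (hσ g).right_inv y (hy1 g (hCf.mem_toFinset.1 hg)), ?_, ?_⟩
  · intro g hg g' hg' hgg
    rw [hCf.coe_toFinset] at hg hg'
    by_contra hne
    refine disjoint_left.1 (hUd hg hg' hne) (hOU g ((hσ g).mapsTo_section (hy1 g hg))) ?_
    simp only at hgg
    rw [hgg]
    exact hOU g' ((hσ g').mapsTo_section (hy1 g' hg'))
  · intro h hhy hhK
    have hhD : h ∉ D := fun hh => hy2 _ hhK ⟨h, hh, by simp only [hhy]⟩
    have : h ∈ ⋃ g ∈ C, O g := by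
      by_contra hn
      exact hhD ⟨hhK, hn⟩
    obtain ⟨g, hg, hgh⟩ := mem_iUnion₂.1 this
    refine ⟨g, hCf.mem_toFinset.2 hg, ?_⟩
    rw [← hhy]
    exact (hσ g).left_inv h hgh

/-- The fibre sum as a finite sum over local sections. -/
theorem fiberSum_eq_sum {a : G → ℝ} {K : Set M} (ha : ∀ h, a h ≠ 0 → 𝒢.tgt h ∈ K) {y : M}
    {t : Finset G} {σ : G → M → G} (h1 : ∀ g ∈ t, 𝒢.src (σ g y) = y)
    (h2 : InjOn (fun g => σ g y) t)
    (h3 : ∀ h, 𝒢.src h = y → 𝒢.tgt h ∈ K → ∃ g ∈ t, σ g y = h) :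
    𝒢.fiberSum a y = ∑ g ∈ t, a (σ g y) := by
  have e : 𝒢.fiberSum a y = ∑ᶠ h ∈ (fun g => σ g y) '' (t : Set G), a h := by
    refine finsum_mem_inter_support_eq' _ _ _ fun h hh => ⟨fun hy => ?_, ?_⟩
    · exact h3 h hy (ha h hh)
    · rintro ⟨g, hg, rfl⟩
      exact h1 g hg
  rw [e, finsum_mem_image h2, finsum_mem_coe_finset]

/-- Fibre sums of pull-backs under the target map are invariant. -/
theorem fiberSum_comp_tgt (b : M → ℝ) (g : G) :
    𝒢.fiberSum (b ∘ 𝒢.tgt) (𝒢.tgt g) = 𝒢.fiberSum (b ∘ 𝒢.tgt) (𝒢.src g) := by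
  refine finsum_mem_eq_of_bijOn (fun h => 𝒢.mul h g) ⟨?_, ?_, ?_⟩ ?_
  · intro h hh
    exact 𝒢.src_mul h g hh
  · intro h hh h' hh' e
    have key : ∀ h, 𝒢.src h = 𝒢.tgt g → 𝒢.mul (𝒢.mul h g) (𝒢.inv g) = h := fun h hh => by
      rw [𝒢.mul_assoc h g _ hh (𝒢.tgt_inv g).symm, 𝒢.mul_inv, ← hh, 𝒢.mul_one]
    rw [← key h hh, ← key h' hh']
    exact congrArg (fun k => 𝒢.mul k (𝒢.inv g)) e
  · intro h hh
    have hh : 𝒢.src h = 𝒢.src g := hh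
    refine ⟨𝒢.mul h (𝒢.inv g), ?_, ?_⟩
    · change 𝒢.src _ = _
      rw [𝒢.src_mul _ _ (by rw [hh, 𝒢.tgt_inv]), 𝒢.src_inv]
    · change 𝒢.mul (𝒢.mul h (𝒢.inv g)) g = h
      rw [𝒢.mul_assoc _ _ _ (by rw [hh, 𝒢.tgt_inv]) (𝒢.src_inv g), 𝒢.inv_mul, ← hh, 𝒢.mul_one]
  · intro h hh
    exact (congrArg b (𝒢.tgt_mul h g hh)).symm

variable [T2Space M] [T2Space G]

theorem IsEtale.contMDiffAt_fiberSum (he : 𝒢.IsEtale) (hp : 𝒢.IsProper) {K : Set M}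
    (hK : IsCompact K) {a : G → ℝ} (ha : ∀ h, a h ≠ 0 → 𝒢.tgt h ∈ K) {x : M}
    (hs : ∀ h, 𝒢.src h = x → ContMDiffAt 𝓘(ℝ, F) 𝓘(ℝ, ℝ) ∞ a h) :
    ContMDiffAt 𝓘(ℝ, E) 𝓘(ℝ, ℝ) ∞ (𝒢.fiberSum a) x := by
  obtain ⟨t, σ, h1, h2⟩ := he.exists_sections hp hK x
  have : ContMDiffAt 𝓘(ℝ, E) 𝓘(ℝ, ℝ) ∞ (fun y => ∑ g ∈ t, a (σ g y)) x := by
    refine contMDiffAt_finsetSum fun g hg => ?_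
    obtain ⟨hgx, hgσ, hσ⟩ := h1 g hg
    exact ContMDiffAt.comp x (by rw [hgσ]; exact hs g hgx) hσ
  refine this.congr_of_eventuallyEq ?_
  filter_upwards [h2] with y hy
  exact fiberSum_eq_sum ha hy.1 hy.2.1 hy.2.2

/-- On the fibre over x the factor `c ∘ src` is the constant `c x`; finiteness of the relevant
arrows justifies splitting the sum. -/
theorem IsEtale.fiberSum_sub_mul (he : 𝒢.IsEtale) (hp : 𝒢.IsProper) {K : Set M}
    (hK : IsCompact K) {a b : G → ℝ} (ha : ∀ h, a h ≠ 0 → 𝒢.tgt h ∈ K)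
    (hb : ∀ h, b h ≠ 0 → 𝒢.tgt h ∈ K) (c : M → ℝ) (x : M) :
    𝒢.fiberSum (fun h => a h - b h * c (𝒢.src h)) x = 𝒢.fiberSum a x - 𝒢.fiberSum b x * c x := by
  obtain ⟨t, σ, -, h2⟩ := he.exists_sections hp hK x
  obtain ⟨h1, h2, h3⟩ := h2.self_of_nhds
  rw [fiberSum_eq_sum ha h1 h2 h3, fiberSum_eq_sum hb h1 h2 h3, fiberSum_eq_sum _ h1 h2 h3,
    Finset.sum_sub_distrib, Finset.sum_mul]
  · refine congrArg _ (Finset.sum_congr rfl fun g hg => ?_)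
    rw [h1 g hg]
  · intro h hh
    by_contra hn
    have e1 : a h = 0 := by by_contra h'; exact hn (ha h h')
    have e2 : b h = 0 := by by_contra h'; exact hn (hb h h')
    exact hh (by rw [e1, e2, zero_mul, sub_zero])

theorem IsEtale.fiberSum_pos (he : 𝒢.IsEtale) (hp : 𝒢.IsProper) {K : Set M}
    (hK : IsCompact K) {a : G → ℝ} (ha : ∀ h, a h ≠ 0 → 𝒢.tgt h ∈ K) (h0 : ∀ h, 0 ≤ a h) {g : G}
    (hg : 0 < a g) : 0 < 𝒢.fiberSum a (𝒢.src g) := by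
  obtain ⟨t, σ, -, h2⟩ := he.exists_sections hp hK (𝒢.src g)
  obtain ⟨h1, h2, h3⟩ := h2.self_of_nhds
  rw [fiberSum_eq_sum ha h1 h2 h3]
  obtain ⟨k, hk, e⟩ := h3 g rfl (ha g hg.ne')
  refine Finset.sum_pos' (fun _ _ => h0 _) ⟨k, hk, ?_⟩
  rwa [e]

end LieGroupoid

/-! ### Change of coefficients in the periods -/

namespace LieGroupoid

variable {E F M G : Type*}
    [NormedAddCommGroup E] [NormedSpace ℝ E] [NormedAddCommGroup F] [NormedSpace ℝ F]
    [TopologicalSpace M] [ChartedSpace E M] [IsManifold 𝓘(ℝ, E) ∞ M]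
    [TopologicalSpace G] [ChartedSpace F G]
    {𝒢 : LieGroupoid E F M G}

/-- A form is basic if its local primitives are locally invariant up to constants. -/
theorem isBasicForm_of_isPrimitiveAt {θ : OneForm E M}
    (h : ∀ g, ∃ f f' : M → ℝ, θ.IsPrimitiveAt f (𝒢.tgt g) ∧ θ.IsPrimitiveAt f' (𝒢.src g) ∧
      ∀ᶠ k in 𝓝 g, f (𝒢.tgt k) - f' (𝒢.src k) = f (𝒢.tgt g) - f' (𝒢.src g)) :
    𝒢.IsBasicForm θ := by
  intro g v
  obtain ⟨f, f', hf, hf', he⟩ := h g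
  have dt : MDifferentiableAt 𝓘(ℝ, F) 𝓘(ℝ, E) 𝒢.tgt g :=
    𝒢.contMDiff_tgt.mdifferentiableAt (by decide)
  have ds : MDifferentiableAt 𝓘(ℝ, F) 𝓘(ℝ, E) 𝒢.src g :=
    𝒢.contMDiff_src.mdifferentiableAt (by decide)
  have df := hf.contMDiffAt.mdifferentiableAt (by decide)
  have df' := hf'.contMDiffAt.mdifferentiableAt (by decide)
  have e1 := mfderiv_comp (I'' := 𝓘(ℝ, ℝ)) g df dt
  have e2 := mfderiv_comp (I'' := 𝓘(ℝ, ℝ)) g df' ds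
  have e3 : f ∘ 𝒢.tgt =ᶠ[𝓝 g]
      (f' ∘ 𝒢.src) + fun _ => f (𝒢.tgt g) - f' (𝒢.src g) := by
    filter_upwards [he] with k hk
    simp only [Pi.add_apply, Function.comp]
    linarith
  have e4 : (mfderiv 𝓘(ℝ, F) 𝓘(ℝ, ℝ) (f ∘ 𝒢.tgt) g : F →L[ℝ] ℝ) =
      mfderiv 𝓘(ℝ, F) 𝓘(ℝ, ℝ) (f' ∘ 𝒢.src) g := by
    rw [e3.mfderiv_eq, mfderiv_add (df'.comp g ds) mdifferentiableAt_const, mfderiv_const]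
    exact add_zero _
  refine (hf'.self_of_nhds.2 _).trans (Eq.trans ?_ (hf.self_of_nhds.2 _).symm)
  refine (congrArg (fun L : F →L[ℝ] ℝ => L v) e2).symm.trans
    (Eq.trans ?_ (congrArg (fun L : F →L[ℝ] ℝ => L v) e1))
  exact (congrArg (fun L : F →L[ℝ] ℝ => L v) e4).symm

variable [FiniteDimensional ℝ E] [T2Space M] [IsManifold 𝓘(ℝ, F) ∞ G] [T2Space G]

/-- For every additive map `ψ : ℝ → ℝ` there is an invariant function `u` such that the functions
`u + ψ ∘ f`, for the local primitives `f` of `θ`, are smooth. -/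
theorem exists_smooth_add_comp (he : 𝒢.IsEtale) (hp : 𝒢.IsProper)
    (hc : CompactSpace 𝒢.OrbitSpace) (θ : 𝒢.closedBasicForms) (ψ : ℝ →+ ℝ) :
    ∃ u : M → ℝ, (∀ g, u (𝒢.tgt g) = u (𝒢.src g)) ∧
      ∀ x f, (θ : OneForm E M).IsPrimitiveAt f x →
        ContMDiffAt 𝓘(ℝ, E) 𝓘(ℝ, ℝ) ∞ (fun y => u y + ψ (f y)) x := by
  choose V hVo hpV ℓ hℓ using 𝒢.exists_linear_primitive
  let φ : M → M → ℝ := fun p y => ℓ p y θ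
  have hφ : ∀ p, ∀ y ∈ V p, (θ : OneForm E M).IsPrimitiveAt (φ p) y := fun p y hy => hℓ p θ y hy
  have hbump : ∀ p, ∃ ρ : SmoothBumpFunction 𝓘(ℝ, E) p, tsupport ρ ⊆ V p := fun p => by
    obtain ⟨ρ, -, hρ⟩ := (SmoothBumpFunction.nhds_basis_tsupport (I := 𝓘(ℝ, E)) p).mem_iff.1
      ((hVo p).mem_nhds (hpV p))
    exact ⟨ρ, hρ⟩
  choose ρ hρ using hbump
  obtain ⟨s, hs⟩ := he.exists_finset_forall_orbit hc fun p => (ρ p).support_mem_nhds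
  let r : M → ℝ := fun y => ∑ p ∈ s, ρ p y
  let v : M → ℝ := fun y => ∑ p ∈ s, ρ p y * ψ (φ p y)
  let K : Set M := ⋃ p ∈ s, tsupport (ρ p)
  have hK : IsCompact K := s.finite_toSet.isCompact_biUnion fun p _ => (ρ p).hasCompactSupport
  have hout : ∀ y, y ∉ K → ∀ p ∈ s, ρ p y = 0 := fun y hy p hps =>
    image_eq_zero_of_notMem_tsupport fun h => hy (mem_biUnion hps h)
  have hr : ∀ h, (r ∘ 𝒢.tgt) h ≠ 0 → 𝒢.tgt h ∈ K := fun h hh => by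
    by_contra hn
    exact hh (Finset.sum_eq_zero (hout _ hn))
  have hv : ∀ h, (v ∘ 𝒢.tgt) h ≠ 0 → 𝒢.tgt h ∈ K := fun h hh => by
    by_contra hn
    exact hh (Finset.sum_eq_zero fun p hps => by rw [hout _ hn p hps, zero_mul])
  set W := 𝒢.fiberSum (r ∘ 𝒢.tgt)
  have hWpos : ∀ x, 0 < W x := by
    intro x
    obtain ⟨p, hps, h, rfl, hh⟩ := hs x
    refine he.fiberSum_pos hp hK hr (fun h => Finset.sum_nonneg fun p _ => (ρ p).nonneg)
      (Finset.sum_pos' (fun p _ => (ρ p).nonneg) ⟨p, hps, ?_⟩)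
    exact (ρ p).nonneg.lt_of_ne' hh
  have hWs : ∀ x, ContMDiffAt 𝓘(ℝ, E) 𝓘(ℝ, ℝ) ∞ W x := fun x =>
    he.contMDiffAt_fiberSum hp hK hr fun h _ =>
      (contMDiffAt_finsetSum fun p _ => (ρ p).contMDiffAt).comp h 𝒢.contMDiff_tgt.contMDiffAt
  -- u is minus the weighted average, over arrows h out of x, of `ψ (φ p (tgt h))` with weights `ρ p
  -- (tgt h)`. Fibre sums of pull-backs by the target are invariant.
  refine ⟨fun x => -(𝒢.fiberSum (v ∘ 𝒢.tgt) x / W x), fun g => ?_, fun x f hf => ?_⟩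
  · simp only [W, fiberSum_comp_tgt]
  -- By additivity of ψ, adding ψ ∘ f to u turns the averaged quantity into `ψ (φ p (tgt h) - f (src
  -- h))`, up to sign.
  let a : G → ℝ := fun h => (v ∘ 𝒢.tgt) h - (r ∘ 𝒢.tgt) h * ψ (f (𝒢.src h))
  have hae : ∀ h, a h = ∑ p ∈ s, ρ p (𝒢.tgt h) * ψ (φ p (𝒢.tgt h) - f (𝒢.src h)) := by
    intro h
    simp only [a, v, r, Function.comp, Finset.sum_mul, ← Finset.sum_sub_distrib, map_sub, mul_sub]
  have ha : ∀ h, a h ≠ 0 → 𝒢.tgt h ∈ K := fun h hh => by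
    by_contra hn
    rw [hae] at hh
    exact hh (Finset.sum_eq_zero fun p hps => by rw [hout _ hn p hps, zero_mul])
  have has : ContMDiffAt 𝓘(ℝ, E) 𝓘(ℝ, ℝ) ∞ (𝒢.fiberSum a) x := by
    refine he.contMDiffAt_fiberSum hp hK ha fun h hhx => ?_
    rw [show a = _ from funext hae]
    refine contMDiffAt_finsetSum fun p _ => ?_
    have hρs : ContMDiffAt 𝓘(ℝ, F) 𝓘(ℝ, ℝ) ∞ (fun k => ρ p (𝒢.tgt k)) h :=
      (ρ p).contMDiffAt.comp h 𝒢.contMDiff_tgt.contMDiffAt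
    -- On the support the argument of ψ is locally constant because θ is basic, so a discontinuous ψ
    -- does no harm. Off the support the term vanishes near h.
    by_cases hh : 𝒢.tgt h ∈ tsupport (ρ p)
    · refine (hρs.mul (contMDiffAt_const (c := ψ (φ p (𝒢.tgt h) - f (𝒢.src h))))).congr_of_eventuallyEq ?_
      filter_upwards [θ.2.2.eventually_sub_eq (g := h) (hφ p _ (hρ p hh)) (hhx ▸ hf)] with k hk
      rw [hk]
      rfl
    · refine (contMDiffAt_const (c := (0 : ℝ))).congr_of_eventuallyEq ?_
      filter_upwards [𝒢.contMDiff_tgt.continuous.continuousAt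
        ((isClosed_tsupport (ρ p)).isOpen_compl.mem_nhds hh)] with k hk
      rw [image_eq_zero_of_notMem_tsupport hk, zero_mul]
  have hfin : (fun y => -(𝒢.fiberSum (v ∘ 𝒢.tgt) y / W y) + ψ (f y)) =
      fun y => -(𝒢.fiberSum a y * (W y)⁻¹) := by
    funext y
    have h1 := he.fiberSum_sub_mul hp hK hv hr (fun z => ψ (f z)) y
    have h2 : 𝒢.fiberSum a y = 𝒢.fiberSum (v ∘ 𝒢.tgt) y - W y * ψ (f y) := h1
    rw [h2]
    have := (hWpos y).ne'
    field_simp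
    ring
  rw [hfin]
  exact (has.mul ((hWs x).inv₀ (hWpos x).ne')).neg

/-- Change of coefficients: for every additive map `ψ : ℝ → ℝ` there is a closed basic form whose
local primitives are `u + ψ ∘ f`, for an invariant function `u` and the local primitives `f`
of `θ`. -/
theorem exists_isPrimitiveAt_add_comp (he : 𝒢.IsEtale) (hp : 𝒢.IsProper)
    (hc : CompactSpace 𝒢.OrbitSpace) (θ : 𝒢.closedBasicForms) (ψ : ℝ →+ ℝ) :
    ∃ (η : 𝒢.closedBasicForms) (u : M → ℝ), (∀ g, u (𝒢.tgt g) = u (𝒢.src g)) ∧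
      ∀ x f, (θ : OneForm E M).IsPrimitiveAt f x →
        (η : OneForm E M).IsPrimitiveAt (fun y => u y + ψ (f y)) x := by
  obtain ⟨u, hu, hs⟩ := exists_smooth_add_comp he hp hc θ ψ
  choose f hf using fun x => θ.2.1.exists_primitiveAt x
  have hdiff : ∀ {y : M} {f f' : M → ℝ}, (θ : OneForm E M).IsPrimitiveAt f y →
      (θ : OneForm E M).IsPrimitiveAt f' y → ∀ᶠ z in 𝓝 y,
        (u z + ψ (f z)) - (u y + ψ (f y)) = (u z + ψ (f' z)) - (u y + ψ (f' y)) := by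
    intro y f f' h h'
    filter_upwards [h.sub_eventually_eq h'] with z hz
    have := congrArg ψ hz
    rw [map_sub, map_sub] at this
    linarith
  obtain ⟨η, hη⟩ := OneForm.exists_isPrimitiveAt_of_local (E := E)
    (fun x y => u y + ψ (f x y)) (fun x => by
      filter_upwards [(hf x).eventually] with y hy
      exact ⟨hs y _ hy, hdiff (hf y) hy⟩)
  have hη' : ∀ x f, (θ : OneForm E M).IsPrimitiveAt f x →
      η.IsPrimitiveAt (fun y => u y + ψ (f y)) x := by
    intro x f' hf'
    refine ((hη x).add_const (ψ (f' x) - ψ (f x x))).congr ?_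
    filter_upwards [hdiff hf' (hf x)] with z hz
    linarith
  refine ⟨⟨η, OneForm.isClosedForm_of_isPrimitiveAt fun x => ⟨_, hη x⟩,
    isBasicForm_of_isPrimitiveAt fun g => ⟨_, _, hη _, hη _, ?_⟩⟩, u, hu, hη'⟩
  filter_upwards [θ.2.2.eventually_sub_eq (hf (𝒢.tgt g)) (hf (𝒢.src g))] with k hk
  have := congrArg ψ hk
  rw [map_sub, map_sub] at this
  rw [hu, hu]
  linarith

end LieGroupoid

/-! ### Rational classes -/

theorem OneForm.IsPrimitiveAt.sum {E M : Type*} [NormedAddCommGroup E] [NormedSpace ℝ E]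
    [TopologicalSpace M] [ChartedSpace E M] [IsManifold 𝓘(ℝ, E) ∞ M] {ι : Type*} (s : Finset ι)
    {θ : ι → OneForm E M} {f : ι → M → ℝ} {x : M} (h : ∀ i ∈ s, (θ i).IsPrimitiveAt (f i) x) :
    (∑ i ∈ s, θ i).IsPrimitiveAt (fun y => ∑ i ∈ s, f i y) x := by
  classical
  induction s using Finset.induction_on with
  | empty =>
    refine Eventually.of_forall fun y => ⟨?_, fun v => ?_⟩
    · simpa using contMDiffAt_const
    · simp only [Finset.sum_empty]
      rw [mfderiv_const]
      rfl
  | insert i s hi ih =>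
    simp only [Finset.sum_insert hi]
    exact (h i (Finset.mem_insert_self i s)).add
      (ih fun j hj => h j (Finset.mem_insert_of_mem hj))

/-- A nontrivial group of rational numbers has rank one. -/
theorem AddSubgroup.rank_eq_one_of_le_range_ratCast {P : AddSubgroup ℝ}
    (hP : P ≤ (Rat.castHom ℝ).toAddMonoidHom.range) (h0 : P ≠ ⊥) : Module.rank ℤ P = 1 := by
  refine le_antisymm ?_ ?_
  · calc Module.rank ℤ P ≤ Module.rank ℤ (Rat.castHom ℝ).toAddMonoidHom.range :=
        LinearMap.rank_le_of_injective (AddSubgroup.inclusion hP).toIntLinearMap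
          (AddSubgroup.inclusion_injective hP)
      _ ≤ Module.rank ℤ ℚ := LinearMap.rank_le_of_surjective
          (Rat.castHom ℝ).toAddMonoidHom.rangeRestrict.toIntLinearMap (Rat.castHom ℝ).toAddMonoidHom.rangeRestrict_surjective
      _ = 1 := by rw [← IsFractionRing.rank_right_eq ℤ ℚ ℚ, Module.rank_self]
  · have : Nontrivial P := (AddSubgroup.nontrivial_iff_ne_bot P).2 h0
    exact Cardinal.one_le_iff_pos.2 rank_pos

/-- A set that is closed under rational linear combinations and spans a finite-dimensional real
vector space is dense in it, even after removing zero. -/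
theorem dense_diff_singleton_zero_of_span {H : Type*} [AddCommGroup H] [Module ℝ H]
    [FiniteDimensional ℝ H] [Nontrivial H] {R : Set H}
    (h : ∀ ξ : H, ∃ (n : ℕ) (a : Fin n → ℝ) (η : Fin n → H), ξ = ∑ i, a i • η i ∧
      ∀ b : Fin n → ℚ, ∑ i, (b i : ℝ) • η i ∈ R) :
    @Dense H (moduleTopology ℝ H) (R \ {0}) := by
  let _ : TopologicalSpace H := moduleTopology ℝ H
  have : IsModuleTopology ℝ H := ⟨rfl⟩
  have : ContinuousAdd H := IsModuleTopology.toContinuousAdd ℝ H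
  have : ContinuousSMul ℝ H := IsModuleTopology.toContinuousSMul ℝ H
  have : T2Space H := T2Space.of_injective_continuous (Module.finBasis ℝ H).equivFun.injective
    (IsModuleTopology.continuous_of_linearMap
      ((Module.finBasis ℝ H).equivFun : H →ₗ[ℝ] Fin (Module.finrank ℝ H) → ℝ))
  have hR : Dense R := by
    intro ξ
    obtain ⟨n, a, η, rfl, hη⟩ := h ξ
    -- The real coefficients of ξ are approximated by rational ones with the vectors η kept fixed.
    have hd : DenseRange (fun (b : Fin n → ℚ) i => (b i : ℝ)) :=
      DenseRange.piMap fun _ => Rat.denseRange_cast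
    have hc : Continuous fun b : Fin n → ℝ => ∑ i, b i • η i := by fun_prop
    refine closure_mono ?_ (hc.range_subset_closure_image_dense hd ⟨a, rfl⟩)
    rintro _ ⟨_, ⟨b, rfl⟩, rfl⟩
    exact hη b
  have : (𝓝[≠] (0 : H)).NeBot := Module.punctured_nhds_neBot ℝ H 0
  exact hR.inter_of_isOpen_right (dense_compl_singleton (0 : H)) isOpen_compl_singleton

namespace LieGroupoid

variable {E F M G : Type*}
    [NormedAddCommGroup E] [NormedSpace ℝ E] [NormedAddCommGroup F] [NormedSpace ℝ F]
    [TopologicalSpace M] [ChartedSpace E M] [IsManifold 𝓘(ℝ, E) ∞ M]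
    [TopologicalSpace G] [ChartedSpace F G]
    {𝒢 : LieGroupoid E F M G}

variable (𝒢) in
/-- The classes of the forms that have an invariant primitive modulo `ℚ`. -/
def rationalClasses : Set 𝒢.BasicH1 :=
  {ξ | ∃ (θ : 𝒢.closedBasicForms) (q : M → ℝ), 𝒢.basicClass θ = ξ ∧
    𝒢.IsPrimitiveModulo (θ : OneForm E M) (Rat.castHom ℝ).toAddMonoidHom.range q}

theorem IsPrimitiveModulo.sum_smul_ratCast {ι : Type*} (s : Finset ι) {θ : ι → OneForm E M}
    {q : ι → M → ℝ} (h : ∀ i, 𝒢.IsPrimitiveModulo (θ i) (Rat.castHom ℝ).toAddMonoidHom.range (q i))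
    (b : ι → ℚ) : 𝒢.IsPrimitiveModulo (∑ i ∈ s, (b i : ℝ) • θ i) (Rat.castHom ℝ).toAddMonoidHom.range
      (fun y => ∑ i ∈ s, b i * q i y) := by
  classical
  induction s using Finset.induction_on with
  | empty =>
    simp only [Finset.sum_empty]
    -- The sum over an empty index type supplies the zero primitive of the zero form.
    refine ⟨fun x => ⟨_, OneForm.IsPrimitiveAt.sum (ι := Empty) ∅ (θ := Empty.elim)
      (f := fun _ _ => 0) (by simp), ?_⟩, fun g => ?_⟩
    · simp
    · simp
  | insert i s hi ih =>
    simp only [Finset.sum_insert hi]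
    refine ((h i).smul ?_).add ih
    rintro _ ⟨c, rfl⟩
    exact ⟨b i * c, by simp⟩

variable [FiniteDimensional ℝ E] [IsManifold 𝓘(ℝ, F) ∞ G]

/-- All periods are rational, and they cannot all vanish, since a form without periods is exact. -/
theorem hasRank_one_of_mem_rationalClasses (hconn : 𝒢.IsGConnected) {ξ : 𝒢.BasicH1}
    (hξ : ξ ∈ 𝒢.rationalClasses) (h0 : ξ ≠ 0) : 𝒢.HasRank ξ 1 := by
  obtain ⟨θ, q, rfl, hq⟩ := hξ
  refine ⟨_, isPeriodHom_periodHom θ, ?_⟩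
  rw [Nat.cast_one]
  refine AddSubgroup.rank_eq_one_of_le_range_ratCast ?_ fun hbot => h0 ?_
  · rintro _ ⟨z, rfl⟩
    obtain ⟨z, rfl⟩ := Submodule.Quotient.mk_surjective _ z
    exact hq.chainIntegral_mem θ.2.1 z z.2
  · refine (Submodule.Quotient.mk_eq_zero _).2 (hconn.mem_exactBasicForms fun z hz => ?_)
    exact AddSubgroup.mem_bot.1 (hbot ▸ ⟨Submodule.Quotient.mk ⟨z, hz⟩, rfl⟩)

variable [T2Space M] [T2Space G]

theorem exists_eq_sum_smul_rational (he : 𝒢.IsEtale) (hp : 𝒢.IsProper)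
    (hc : CompactSpace 𝒢.OrbitSpace) (θ : 𝒢.closedBasicForms) :
    ∃ (n : ℕ) (a : Fin n → ℝ) (η : Fin n → 𝒢.closedBasicForms) (r : Fin n → M → ℝ),
      𝒢.basicClass θ = ∑ i, a i • 𝒢.basicClass (η i) ∧
      ∀ i, 𝒢.IsPrimitiveModulo (η i : OneForm E M) (Rat.castHom ℝ).toAddMonoidHom.range (r i) := by
  obtain ⟨𝓛, hfin, h𝓛⟩ := exists_finite_functionals he hp hc
  obtain ⟨q, hq⟩ := h𝓛 θ
  set S : Set ℝ := (fun L : 𝒢.closedBasicForms →ₗ[ℝ] ℝ => L θ) '' 𝓛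
  set A : Submodule ℚ ℝ := Submodule.span ℚ S
  have : FiniteDimensional ℚ A := FiniteDimensional.span_of_finite ℚ (hfin.image _)
  have hSA : ∀ x ∈ AddSubgroup.closure S, x ∈ A := by
    have : AddSubgroup.closure S ≤ A.toAddSubgroup :=
      (AddSubgroup.closure_le _).2 Submodule.subset_span
    exact fun x hx => this hx
  let b := Module.finBasis ℚ A
  -- The coordinates are extended from A to all of ℝ because the local primitives take arbitrary
  -- real values.
  choose c hcoord using fun i => LinearMap.exists_extend (b.coord i)
  let ψ : Fin (Module.finrank ℚ A) → ℝ →+ ℝ := fun i =>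
    (Rat.castHom ℝ).toAddMonoidHom.comp (c i).toAddMonoidHom
  have hψQ : ∀ i x, ψ i x ∈ (Rat.castHom ℝ).toAddMonoidHom.range := fun i x => ⟨c i x, rfl⟩
  -- The expansion holds only on A, which suffices: it is applied to the differences f - q and to
  -- the jumps of q along arrows.
  have hψ : ∀ x ∈ A, x - ∑ i, (b i : ℝ) * ψ i x = 0 := by
    intro x hx
    have h1 := congrArg (A.subtype) (b.sum_repr ⟨x, hx⟩)
    have h2 : ∀ i, c i x = b.repr ⟨x, hx⟩ i := fun i =>
      LinearMap.congr_fun (hcoord i) ⟨x, hx⟩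
    have h3 : ∀ i, (b i : ℝ) * ψ i x = (b.repr ⟨x, hx⟩ i) • (b i : ℝ) := fun i => by
      rw [← h2, Rat.smul_def, mul_comm]
      rfl
    rw [sub_eq_zero, Finset.sum_congr rfl fun i _ => h3 i]
    simp only [map_sum, map_smul, Submodule.subtype_apply] at h1
    exact h1.symm
  choose η u hu hη using fun i => exists_isPrimitiveAt_add_comp he hp hc θ (ψ i)
  refine ⟨_, fun i => (b i : ℝ), η, fun i y => u i y + ψ i (q y), ?_,
    fun i => ⟨fun x => ?_, fun g => ?_⟩⟩
  · have hex : θ - ∑ i, (b i : ℝ) • η i ∈ 𝒢.exactBasicForms := by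
      refine IsPrimitiveModulo.mem_exactBasicForms
        (q := fun y => q y - ∑ i, (b i : ℝ) * (u i y + ψ i (q y))) ⟨fun x => ?_, fun g => ?_⟩
      · obtain ⟨f, hf, hfq⟩ := hq.1 x
        have h1 := (hf.add ((OneForm.IsPrimitiveAt.sum Finset.univ
          fun i _ => (hη i x f hf).smul (b i : ℝ)).smul (-1)))
        refine ⟨fun y => f y + -1 * ∑ i, (b i : ℝ) * (u i y + ψ i (f y)), ?_, ?_⟩
        · convert h1 using 1
          simp only [sub_eq_add_neg, Submodule.coe_add, Submodule.coe_neg, Submodule.coe_sum,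
            Submodule.coe_smul]
          exact congrArg _ (neg_one_smul ℝ _).symm
        · filter_upwards [hfq] with y hy
          have := hψ _ (hSA _ hy)
          simp only [map_sub, mul_sub, Finset.sum_sub_distrib] at this
          simp only [AddSubgroup.mem_bot, mul_add, Finset.sum_add_distrib]
          linarith
      · have := hψ _ (hSA _ (hq.2 g))
        simp only [map_sub, mul_sub, Finset.sum_sub_distrib] at this
        simp only [AddSubgroup.mem_bot, mul_add, Finset.sum_add_distrib, hu]
        linarith
    have := (Submodule.Quotient.eq _).2 hex
    refine Eq.trans this ?_
    exact (map_sum 𝒢.exactBasicForms.mkQ _ _).trans rfl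
  · obtain ⟨f, hf, -⟩ := hq.1 x
    -- The function u cancels and leaves ψ(f - q), which is rational wherever it is evaluated.
    refine ⟨_, hη i x f hf, Eventually.of_forall fun y => ?_⟩
    rw [add_sub_add_left_eq_sub, ← map_sub]
    exact hψQ i _
  · beta_reduce
    rw [hu, add_sub_add_left_eq_sub, ← map_sub]
    exact hψQ i _

end LieGroupoid

end

/-- For an étale proper `G`-connected Lie groupoid `G ⇉ M` with compact orbit space and
`H¹_bas(G, ℝ) ≠ 0`, the real vector space `H¹_bas(G, ℝ)` is finite-dimensional and the classes of
rank `1` are dense in it for its canonical topology. -/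
theorem mainTheorem11 {E F M G : Type*}
    [NormedAddCommGroup E] [NormedSpace ℝ E] [FiniteDimensional ℝ E]
    [NormedAddCommGroup F] [NormedSpace ℝ F] [FiniteDimensional ℝ F]
    [TopologicalSpace M] [T2Space M] [SecondCountableTopology M]
    [ChartedSpace E M] [IsManifold 𝓘(ℝ, E) ∞ M]
    [TopologicalSpace G] [T2Space G] [SecondCountableTopology G]
    [ChartedSpace F G] [IsManifold 𝓘(ℝ, F) ∞ G]
    (𝒢 : LieGroupoid E F M G) (hconn : 𝒢.IsGConnected)
    (hetale : 𝒢.IsEtale) (hproper : 𝒢.IsProper) (hcompact : CompactSpace 𝒢.OrbitSpace)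
    (hne : ∃ ξ : 𝒢.BasicH1, ξ ≠ 0) :
    FiniteDimensional ℝ 𝒢.BasicH1 ∧
      @Dense 𝒢.BasicH1 (moduleTopology ℝ 𝒢.BasicH1) {ξ | 𝒢.HasRank ξ 1} := by
  have hfin := LieGroupoid.finiteDimensional_basicH1 hetale hproper hcompact
  obtain ⟨ξ₀, hξ₀⟩ := hne
  have : Nontrivial 𝒢.BasicH1 := ⟨ξ₀, 0, hξ₀⟩
  refine ⟨hfin, ?_⟩
  let _ : TopologicalSpace 𝒢.BasicH1 := moduleTopology ℝ 𝒢.BasicH1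
  -- Density is proved for the smaller set of nonzero rational classes.
  refine Dense.mono (fun ξ hξ => LieGroupoid.hasRank_one_of_mem_rationalClasses hconn hξ.1 hξ.2)
    (dense_diff_singleton_zero_of_span (R := 𝒢.rationalClasses) fun ξ => ?_)
  obtain ⟨θ, rfl⟩ := Submodule.Quotient.mk_surjective _ ξ
  obtain ⟨n, a, η, r, hθ, hr⟩ := LieGroupoid.exists_eq_sum_smul_rational hetale hproper hcompact θ
  refine ⟨n, a, fun i => 𝒢.basicClass (η i), hθ, fun b => ⟨∑ i, (b i : ℝ) • η i, fun y => ∑ i, b i * r i y, ?_, ?_⟩⟩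
  · exact (map_sum 𝒢.exactBasicForms.mkQ _ _).trans rfl
  · have := LieGroupoid.IsPrimitiveModulo.sum_smul_ratCast Finset.univ hr b
    convert this using 1
    simp
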